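/- Let $X=[0,1]^{\mathbb N_0}$ with the metric $d_X(x,y)=\sum_{i\ge 0}|x_i-y_i|/2^{i+1}$ and the shift $\sigma(x)_i=x_{i+1}$, let $h:[0,1]^2\to\mathbb R$ be Lipschitz continuous, and let $\varphi(x)=h(x_0,x_1)$ for $x\in X$. Let $\alpha_\varphi=\inf_\mu\int\varphi\,d\mu$, the infimum being over all $\sigma$-invariant Borel probability measures on $X$. For $x,y\in X$, $n\in\mathbb N_0$ and $\varepsilon>0$ put $$B(x,y,n;\varepsilon)=\{z\in X: d_X(x,z)<\varepsilon,\ d_X(\sigma^n z,y)<\varepsilon\},\qquad A_n(z)=\sum_{i=0}^{n-1}\bigl(\varphi(\sigma^i z)-\alpha_\varphi\bigr),$$ $$S_\varphi(x,y)=\lim_{\varepsilon\to0+}\ \inf_{n\ge1}\ \inf_{z\in B(x,y,n;\varepsilon)}A_n(z),\qquad H_\varphi(x,y)=\lim_{\varepsilon\to0+}\ \liminf_{n\to\infty}\ \inf_{z\in B(x,y,n;\varepsilon)}A_n(z),$$ with values in $[-\infty,+\infty]$. The Aubry set is $\Omega_\varphi=\{x\in X: S_\varphi(x,x)=0\}$,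 with the metric $d_X$. For $x,y\in\Omega_\varphi$ let $\delta_\varphi(x,y)=H_\varphi(x,y)+H_\varphi(y,x)$; this is a finite pseudometric on $\Omega_\varphi$. Write $x\sim_\varphi y$ if $\delta_\varphi(x,y)=0$; the quotient Aubry set is $\bar\Omega_\varphi=\Omega_\varphi/{\sim_\varphi}$ with the metric induced by $\delta_\varphi$, and $\pi:\Omega_\varphi\to\bar\Omega_\varphi$ is the projection. Let $\mathrm m_h=\{a\in[0,1]: h(a,a)=\min_{x\in[0,1]}h(x,x)\}\subset\mathbb R$, let $\bar{\mathrm m}_h$ be the quotient of $\mathrm m_h$, with the quotient topology, by the relation of lying in the same connected component of $\mathrm m_h$, and let $a^\infty$ be the constant sequence with value $a$. Let $\mathscr H$ be the set of $C^2$ functions $h$ on $[0,1]^2$ with $D_2D_1h<0$ on $[0,1]^2$. Then: (i) If $h\in\mathscr H$, then $\Omega_\varphi$ is isometric to $\mathrm m_h$, by the map $a\mapsto a^\infty$. (ii) If $h\in\mathscr H$, then $\bar{\mathrm m}_h$ is totally disconnected and $\bar\Omega_\varphi$ is homeomorphic to it, by the map sending the class of $a$ to $\pi(a^\infty)$. (iii)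 If $h(x,y)=\rho(x-y)+\frac12|x-y|$ on $[0,1]^2$ for a $C^2$ function $\rho:\mathbb R\to\mathbb R$ with $\rho''>0$ on $\mathbb R$, then $(\bar\Omega_\varphi,\delta_\varphi)$ is isometric to $[0,1]$ with the usual metric, by the map $a\mapsto\pi(a^\infty)$. -/

import Mathlib

open Set Filter Topology MeasureTheory
open scoped NNReal

noncomputable section

namespace XYModel

/-! ### The phase space and the shift -/

/-- The space `[0,1]^ℕ₀` of one-sided sequences with entries in the unit interval. It carries the
metric `d_X` below (and its topology and Borel σ-algebra), hence it is not an abbreviation. -/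
def SeqSpace : Type := ℕ → unitInterval

instance : CoeFun SeqSpace (fun _ => ℕ → unitInterval) := ⟨fun x => x⟩

theorem summable_dX (x y : SeqSpace) :
    Summable (fun i : ℕ => |(x i : ℝ) - (y i : ℝ)| / 2 ^ (i + 1)) := by
  have hs : Summable (fun i : ℕ => (1 / 2 : ℝ) ^ (i + 1)) :=
    (summable_nat_add_iff 1).2 summable_geometric_two
  refine Summable.of_nonneg_of_le (fun i => by positivity) (fun i => ?_) hs
  have h1 : |(x i : ℝ) - (y i : ℝ)| ≤ 1 := by
    have hx := (x i).2
    have hy := (y i).2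
    rw [abs_le]
    constructor <;> linarith [hx.1, hx.2, hy.1, hy.2]
  rw [one_div, inv_pow, ← one_div]
  exact div_le_div_of_nonneg_right h1 (by positivity)

/-- `d_X(x,y) = ∑_{i ≥ 0} |x_i - y_i| / 2^{i+1}`. -/
instance : MetricSpace SeqSpace where
  dist x y := ∑' i : ℕ, |(x i : ℝ) - (y i : ℝ)| / 2 ^ (i + 1)
  dist_self x := by simp
  dist_comm x y := by simp only [abs_sub_comm]
  dist_triangle x y z := by
    rw [← (summable_dX x y).tsum_add (summable_dX y z)]
    refine (summable_dX x z).tsum_le_tsum (fun i => ?_) ((summable_dX x y).add (summable_dX y z))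
    rw [← add_div]
    exact div_le_div_of_nonneg_right (abs_sub_le _ _ _) (by positivity)
  eq_of_dist_eq_zero {x y} hxy := by
    have h0 := (hasSum_zero_iff_of_nonneg
      (f := fun i : ℕ => |(x i : ℝ) - (y i : ℝ)| / 2 ^ (i + 1))
      (fun i => by positivity)).1 (hxy ▸ (summable_dX x y).hasSum)
    funext i
    have hi := congrFun h0 i
    simp only [Pi.zero_apply, div_eq_zero_iff, abs_eq_zero, sub_eq_zero] at hi
    rcases hi with hi | hi
    · exact Subtype.ext hi
    · exact absurd hi (by positivity)

instance : MeasurableSpace SeqSpace := borel SeqSpace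

instance : BorelSpace SeqSpace := ⟨rfl⟩

/-- The shift `σ(x)_i = x_{i+1}`. -/
def shift (x : SeqSpace) : SeqSpace := fun i => x (i + 1)

/-! ### Action-minimizing objects of a potential `φ : X → ℝ` -/

/-- The optimal ergodic average `α_φ`: the infimum of `∫ φ dμ` over all shift-invariant Borel
probability measures `μ`. -/
def optAverage (φ : SeqSpace → ℝ) : ℝ :=
  sInf {r : ℝ | ∃ μ : Measure SeqSpace,
    IsProbabilityMeasure μ ∧ MeasurePreserving shift μ μ ∧ r = ∫ x, φ x ∂μ}

/-- `∑_{i=0}^{n-1} (φ(σ^i z) - α_φ)`. -/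
def action (φ : SeqSpace → ℝ) (n : ℕ) (z : SeqSpace) : ℝ :=
  ∑ i ∈ Finset.range n, (φ (shift^[i] z) - optAverage φ)

/-- `B(x,y,n;ε) = {z | d_X(x,z) < ε, d_X(σ^n z, y) < ε}`. -/
def connecting (x y : SeqSpace) (n : ℕ) (ε : ℝ) : Set SeqSpace :=
  {z | dist x z < ε ∧ dist (shift^[n] z) y < ε}

/-- `S_φ(x,y;ε)`: the infimum of the action over all `n ≥ 1` and `z ∈ B(x,y,n;ε)`. -/
def maneEps (φ : SeqSpace → ℝ) (x y : SeqSpace) (ε : ℝ) : EReal :=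
  ⨅ n : ℕ, ⨅ _ : 1 ≤ n, ⨅ z ∈ connecting x y n ε, ((action φ n z : ℝ) : EReal)

/-- The Mañé potential `S_φ(x,y) = lim_{ε → 0} S_φ(x,y;ε)`. As `S_φ(x,y;ε)` is monotone in `ε`,
the limit is the supremum (see `tendsto_maneEps`). -/
def mane (φ : SeqSpace → ℝ) (x y : SeqSpace) : EReal :=
  ⨆ ε : ℝ, ⨆ _ : 0 < ε, maneEps φ x y ε

/-- The Aubry set `Ω_φ = {x | S_φ(x,x) = 0}`. -/
def aubrySet (φ : SeqSpace → ℝ) : Set SeqSpace :=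
  {x | mane φ x x = 0}

/-- `H_φ(x,y;ε)`: the `liminf` as `n → ∞` of the infimum of the action over `B(x,y,n;ε)`. -/
def peierlsEps (φ : SeqSpace → ℝ) (x y : SeqSpace) (ε : ℝ) : EReal :=
  liminf (fun n : ℕ => ⨅ z ∈ connecting x y n ε, ((action φ n z : ℝ) : EReal)) atTop

/-- Peierls' barrier `H_φ(x,y) = lim_{ε → 0} H_φ(x,y;ε)`, again a monotone limit
(see `tendsto_peierlsEps`). -/
def peierls (φ : SeqSpace → ℝ) (x y : SeqSpace) : EReal :=
  ⨆ ε : ℝ, ⨆ _ : 0 < ε, peierlsEps φ x y ε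

theorem connecting_mono (x y : SeqSpace) (n : ℕ) {ε ε' : ℝ} (h : ε ≤ ε') :
    connecting x y n ε ⊆ connecting x y n ε' :=
  fun _ hz => ⟨hz.1.trans_le h, hz.2.trans_le h⟩

theorem tendsto_of_antitone_right {f : ℝ → EReal} (hf : Antitone f) :
    Tendsto f (𝓝[>] 0) (𝓝 (⨆ ε : ℝ, ⨆ _ : 0 < ε, f ε)) := by
  refine tendsto_order.2 ⟨fun a ha => ?_, fun a ha => ?_⟩
  · obtain ⟨ε, hε⟩ := lt_iSup_iff.1 ha
    obtain ⟨h0, hlt⟩ := lt_iSup_iff.1 hε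
    filter_upwards [Ioo_mem_nhdsGT h0] with t ht
    exact hlt.trans_le (hf ht.2.le)
  · filter_upwards [self_mem_nhdsWithin] with t ht
    exact (le_iSup₂_of_le (f := fun (ε : ℝ) (_ : 0 < ε) => f ε) t ht le_rfl).trans_lt ha

theorem tendsto_maneEps (φ : SeqSpace → ℝ) (x y : SeqSpace) :
    Tendsto (maneEps φ x y) (𝓝[>] 0) (𝓝 (mane φ x y)) :=
  tendsto_of_antitone_right fun _ _ h => iInf_mono fun n => iInf_mono fun _ =>
    biInf_mono (connecting_mono x y n h)

theorem tendsto_peierlsEps (φ : SeqSpace → ℝ) (x y : SeqSpace) :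
    Tendsto (peierlsEps φ x y) (𝓝[>] 0) (𝓝 (peierls φ x y)) :=
  tendsto_of_antitone_right fun _ _ h => liminf_le_liminf
    (Eventually.of_forall fun n => biInf_mono (connecting_mono x y n h))

/-- `δ_φ(x,y) = H_φ(x,y) + H_φ(y,x)` on the Aubry set. -/
def aubryDelta (φ : SeqSpace → ℝ) (x y : aubrySet φ) : EReal :=
  peierls φ x y + peierls φ y x

/-! ### The quotient Aubry set -/

/-- `d` is a pseudometric with finite values. -/
structure IsFinitePseudoMetric {α : Type*} (d : α → α → EReal) : Prop where
  ne_top : ∀ x y, d x y ≠ ⊤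
  ne_bot : ∀ x y, d x y ≠ ⊥
  self : ∀ x, d x x = 0
  comm : ∀ x y, d x y = d y x
  triangle : ∀ x y z, d x z ≤ d x y + d y z

/-- The pseudometric space given by a finite pseudometric `d`, with distance `d x y`. -/
abbrev IsFinitePseudoMetric.toPseudoMetricSpace {α : Type*} {d : α → α → EReal}
    (hd : IsFinitePseudoMetric d) : PseudoMetricSpace α where
  dist x y := (d x y).toReal
  dist_self x := by simp [hd.self]
  dist_comm x y := by rw [hd.comm]
  dist_triangle x y z := by
    rw [← EReal.toReal_add (hd.ne_top x y) (hd.ne_bot x y) (hd.ne_top y z) (hd.ne_bot y z)]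
    exact EReal.toReal_le_toReal (hd.triangle x y z) (hd.ne_bot x z)
      (EReal.add_lt_top (hd.ne_top x y) (hd.ne_top y z)).ne

/-- The Aubry set, carrying the pseudometric `δ_φ` in place of the restriction of `d_X`. -/
def DeltaAubry (φ : SeqSpace → ℝ) (_ : IsFinitePseudoMetric (aubryDelta φ)) : Type :=
  aubrySet φ

instance (φ : SeqSpace → ℝ) (hδ : IsFinitePseudoMetric (aubryDelta φ)) :
    PseudoMetricSpace (DeltaAubry φ hδ) :=
  hδ.toPseudoMetricSpace

/-- The quotient Aubry set `Ω_φ / ∼_φ`, where `x ∼_φ y` iff `δ_φ(x,y) = 0`, with the metric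
induced by `δ_φ` (see `quotientAubry_mk_eq_iff` and `quotientAubry_dist`). -/
abbrev QuotientAubry (φ : SeqSpace → ℝ) (hδ : IsFinitePseudoMetric (aubryDelta φ)) : Type :=
  SeparationQuotient (DeltaAubry φ hδ)

/-- The projection `π : Ω_φ → Ω_φ / ∼_φ`. -/
def QuotientAubry.proj (φ : SeqSpace → ℝ) (hδ : IsFinitePseudoMetric (aubryDelta φ))
    (x : aubrySet φ) : QuotientAubry φ hδ :=
  SeparationQuotient.mk (X := DeltaAubry φ hδ) x

theorem quotientAubry_dist (φ : SeqSpace → ℝ) (hδ : IsFinitePseudoMetric (aubryDelta φ))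
    (x y : aubrySet φ) :
    ((dist (QuotientAubry.proj φ hδ x) (QuotientAubry.proj φ hδ y) : ℝ) : EReal)
      = aubryDelta φ x y :=
  (congrArg _ (SeparationQuotient.dist_mk (α := DeltaAubry φ hδ) x y)).trans
    (EReal.coe_toReal (hδ.ne_top x y) (hδ.ne_bot x y))

theorem quotientAubry_mk_eq_iff (φ : SeqSpace → ℝ) (hδ : IsFinitePseudoMetric (aubryDelta φ))
    (x y : aubrySet φ) :
    QuotientAubry.proj φ hδ x = QuotientAubry.proj φ hδ y ↔ aubryDelta φ x y = 0 := by
  rw [← quotientAubry_dist φ hδ, EReal.coe_eq_zero, dist_eq_zero]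

/-! ### 2-locally constant potentials

A function on `[0,1]²` is represented by `h : ℝ → ℝ → ℝ`, of which only the values on `[0,1]²`
are used. -/

/-- The potential `φ(x) = h(x_0, x_1)`. -/
def potential (h : ℝ → ℝ → ℝ) (x : SeqSpace) : ℝ := h (x 0) (x 1)

/-- `h` is Lipschitz continuous on `[0,1]²`. -/
def IsLipschitzOnSquare (h : ℝ → ℝ → ℝ) : Prop :=
  ∃ K : ℝ≥0, LipschitzOnWith K (fun p : ℝ × ℝ => h p.1 p.2) (Icc (0 : ℝ) 1 ×ˢ Icc (0 : ℝ) 1)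

/-- The class `ℋ`: `h` is of class `C²` on `[0,1]²` and `D₂ D₁ h < 0` there (the derivatives at
boundary points are the one-sided ones). -/
structure IsTwist (h : ℝ → ℝ → ℝ) : Prop where
  contDiffOn : ContDiffOn ℝ 2 (fun p : ℝ × ℝ => h p.1 p.2) (Icc (0 : ℝ) 1 ×ˢ Icc (0 : ℝ) 1)
  twist : ∀ x ∈ Icc (0 : ℝ) 1, ∀ y ∈ Icc (0 : ℝ) 1,
    derivWithin (fun s => derivWithin (fun t => h t s) (Icc 0 1) x) (Icc 0 1) y < 0

/-- `h^* = min_{x ∈ [0,1]} h(x,x)`. -/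
def diagMin (h : ℝ → ℝ → ℝ) : ℝ := sInf ((fun x => h x x) '' Icc (0 : ℝ) 1)

/-- `m_h = {a ∈ [0,1] | h(a,a) = h^*}`, a subset of `ℝ`. Its quotient by the relation of lying in
the same connected component, with the quotient topology, is `ConnectedComponents (minSet h)`. -/
def minSet (h : ℝ → ℝ → ℝ) : Set ℝ := {a | a ∈ Icc (0 : ℝ) 1 ∧ h a a = diagMin h}

/-- `x` is the constant sequence `a^∞`. -/
def IsConstSeq (a : ℝ) (x : SeqSpace) : Prop := ∀ i, (x i : ℝ) = a

end XYModel

end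

/-!
The proof works with pseudo-orbits: `peierls φ x y ≤ c` means that arbitrarily long orbit segments
from near `x` to near `y` have action below `c + η` (`peierls_le_iff`). Two operations on segments
carry the general part. Splicing (`splice`, `exists_connecting_add`): replacing the tail of a
sequence by one with a nearby head changes the action by at most the Lipschitz constant times the
gap, which gives the triangle inequality, and `peierls x x = 0` on the Aubry set. Closing up
(`neg_le_action`): the measure on a periodic orbit is invariant, so closed segments have nonnegative
action. Together these bound Peierls' barrier and make `δ_φ` a finite pseudometric.

For the explicit potentials everything follows from a lower bound of the action of closed segments
by a sum of local excesses `q(z_i, z_{i+1}) ≥ h(z_i, z_i) - h^* + c (z_i - z_{i+1})²`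
(`HasExcess`). It gives `α_φ = h^*`, and as points of the Aubry set return at almost no cost, all
their excesses vanish: they are constant sequences with value in `m_h`
(`HasExcess.mem_aubrySet_iff`).

For a twist potential the mixed derivative is at most some `-c < 0`, so `h + c x y` is submodular,
and the rearrangement inequality for submodular costs yields the excess
`h(s, s) - h^* + c (s - t)² / 2` (`hasExcess_of_isSubmodular`). If `δ_φ(a^∞, b^∞) = 0`, almost free
round trips move in small steps near `m_h`, so every point between `a` and `b` is in `m_h`
(`HasExcess.Icc_subset_minSet`). Conversely the mixed derivative is bounded below, so
`δ_φ(a^∞, b^∞) ≤ C (a - b)²` on `m_h`, and subdividing an interval contained in `m_h` shows that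
its ends are identified. The map `a ↦ π(a^∞)` thus identifies exactly the points of a common
component, and compactness makes the induced continuous bijection a homeomorphism.

For `h(x, y) = ρ(x - y) + |x - y| / 2` the tangent of `ρ` at `0` telescopes, so the excess is
`|s - t| / 2` and `δ_φ(a^∞, b^∞) ≥ |a - b|`; moving in `n` equal steps shows that this is attained
in the limit (`exists_isometryEquiv_of_corner`).
-/

namespace XYModel


/-! ### The metric and concatenation of sequences -/

theorem dist_def (x y : SeqSpace) :
    dist x y = ∑' i : ℕ, |(x i : ℝ) - (y i : ℝ)| / 2 ^ (i + 1) := rfl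

theorem dist_eq_head_add_shift (x y : SeqSpace) :
    dist x y = |(x 0 : ℝ) - y 0| / 2 + dist (shift x) (shift y) / 2 := by
  rw [dist_def, (summable_dX x y).tsum_eq_zero_add, dist_def, ← tsum_div_const]
  simp only [shift, zero_add, pow_one]
  congr 1
  refine tsum_congr fun i => ?_
  rw [pow_succ _ (i + 1), div_div]

theorem abs_coord_sub_le (x y : SeqSpace) (i : ℕ) :
    |(x i : ℝ) - y i| ≤ 2 ^ (i + 1) * dist x y := by
  have h := (summable_dX x y).le_tsum i (fun j _ => by positivity)
  rw [← dist_def, div_le_iff₀ (by positivity)] at h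
  linarith

theorem dist_le_one (x y : SeqSpace) : dist x y ≤ 1 := by
  rw [dist_def, ← tsum_geometric_two' 1]
  refine (summable_dX x y).tsum_le_tsum (fun i => ?_) (summable_geometric_two' 1)
  have h1 : |(x i : ℝ) - (y i : ℝ)| ≤ 1 := by
    rw [abs_le]
    constructor <;> linarith [(x i).2.1, (x i).2.2, (y i).2.1, (y i).2.2]
  rw [pow_succ', ← div_div]
  gcongr

theorem shift_iterate_apply (n : ℕ) (z : SeqSpace) (i : ℕ) : (shift^[n] z) i = z (n + i) := by
  induction n generalizing z with
  | zero => simp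
  | succ n ih =>
    rw [Function.iterate_succ_apply, ih]
    simp only [shift]
    congr 1
    omega

/-- The sequence `z_0, …, z_{n-1}, w_0, w_1, …`. -/
def splice (n : ℕ) (z w : SeqSpace) : SeqSpace := fun i => if i < n then z i else w (i - n)

theorem splice_of_lt {n i : ℕ} (z w : SeqSpace) (h : i < n) : splice n z w i = z i := if_pos h

theorem splice_self (n : ℕ) (z w : SeqSpace) : splice n z w n = w 0 := by
  simp [splice]

theorem shift_iterate_splice (n : ℕ) (z w : SeqSpace) : shift^[n] (splice n z w) = w := by
  funext i
  rw [shift_iterate_apply]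
  simp [splice]

theorem shift_splice_succ (n : ℕ) (z w : SeqSpace) :
    shift (splice (n + 1) z w) = splice n (shift z) w := by
  funext i
  simp [splice, shift]

/-- Replacing a tail contracts distances, as only the coordinates from `n` on are changed. -/
theorem dist_splice (n : ℕ) (z w : SeqSpace) :
    dist z (splice n z w) = (1 / 2) ^ n * dist (shift^[n] z) w := by
  induction n generalizing z with
  | zero =>
    have : splice 0 z w = w := by funext i; simp [splice]
    simp [this]
  | succ n ih =>
    rw [dist_eq_head_add_shift, shift_splice_succ, ih, splice_of_lt _ _ n.succ_pos,
      Function.iterate_succ_apply]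
    simp
    ring

/-- The constant sequence `a^∞`. -/
def constSeq (a : unitInterval) : SeqSpace := fun _ => a

theorem shift_iterate_constSeq (a : unitInterval) (n : ℕ) :
    shift^[n] (constSeq a) = constSeq a :=
  Function.iterate_fixed rfl n

theorem dist_constSeq (a b : unitInterval) :
    dist (constSeq a) (constSeq b) = |(a : ℝ) - b| := by
  have h := dist_eq_head_add_shift (constSeq a) (constSeq b)
  change _ = |(a : ℝ) - b| / 2 + dist (constSeq a) (constSeq b) / 2 at h
  linarith

/-! ### The action of a spliced sequence -/

/-- `K` is a Lipschitz constant of `h` on the unit square. -/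
abbrev LipSquare (K : ℝ≥0) (h : ℝ → ℝ → ℝ) : Prop :=
  LipschitzOnWith K (fun p : ℝ × ℝ => h p.1 p.2) (Icc (0 : ℝ) 1 ×ˢ Icc (0 : ℝ) 1)

theorem LipSquare.abs_sub_le {K : ℝ≥0} {h : ℝ → ℝ → ℝ} (hK : LipSquare K h)
    (s t s' t' : unitInterval) :
    |h s t - h s' t'| ≤ K * max |(s : ℝ) - s'| |(t : ℝ) - t'| := by
  have := hK.dist_le_mul ((s : ℝ), (t : ℝ)) ⟨s.2, t.2⟩ ((s' : ℝ), (t' : ℝ)) ⟨s'.2, t'.2⟩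
  simpa [Prod.dist_eq, Real.dist_eq] using this

theorem LipSquare.abs_sub_le_right {K : ℝ≥0} {h : ℝ → ℝ → ℝ} (hK : LipSquare K h)
    (s t t' : unitInterval) : |h s t - h s t'| ≤ K * |(t : ℝ) - t'| := by
  simpa using hK.abs_sub_le s t s t'

theorem potential_shift_iterate (h : ℝ → ℝ → ℝ) (n : ℕ) (z : SeqSpace) :
    potential h (shift^[n] z) = h (z n) (z (n + 1)) := by
  simp [potential, shift_iterate_apply]

theorem action_potential (h : ℝ → ℝ → ℝ) (n : ℕ) (z : SeqSpace) :
    action (potential h) n z =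
      ∑ i ∈ Finset.range n, (h (z i) (z (i + 1)) - optAverage (potential h)) := by
  simp only [action, potential_shift_iterate]

theorem action_add (φ : SeqSpace → ℝ) (n m : ℕ) (z : SeqSpace) :
    action φ (n + m) z = action φ n z + action φ m (shift^[n] z) := by
  simp only [action, Finset.sum_range_add, ← Function.iterate_add_apply, add_comm]

theorem action_succ_splice (h : ℝ → ℝ → ℝ) (n : ℕ) (z w : SeqSpace) :
    action (potential h) (n + 1) (splice (n + 1) z w) =
      action (potential h) n z + (h (z n) (w 0) - optAverage (potential h)) := by
  rw [action_potential, action_potential, Finset.sum_range_succ, splice_self,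
    splice_of_lt _ _ n.lt_succ_self]
  congr 1
  refine Finset.sum_congr rfl fun i hi => ?_
  have := Finset.mem_range.1 hi
  rw [splice_of_lt _ _ (by omega), splice_of_lt _ _ (by omega)]

theorem action_splice_sub_le {K : ℝ≥0} {h : ℝ → ℝ → ℝ} (hK : LipSquare K h) (n : ℕ)
    (z w : SeqSpace) :
    |action (potential h) n (splice n z w) - action (potential h) n z|
      ≤ K * |(w 0 : ℝ) - z n| := by
  cases n with
  | zero =>
    simp [action]
    positivity
  | succ n =>
    rw [action_succ_splice, action_potential h (n + 1), Finset.sum_range_succ, ← action_potential]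
    have := hK.abs_sub_le_right (z n) (w 0) (z (n + 1))
    convert this using 2
    ring

/-- Splicing two pseudo-orbits that meet near `y`: no lower bound on the lengths is needed, because
the tail that is replaced is already close to the new one. -/
theorem exists_connecting_add {K : ℝ≥0} {h : ℝ → ℝ → ℝ} (hK : LipSquare K h)
    {x y w z₁ z₂ : SeqSpace} {n m : ℕ} {ε : ℝ} (h₁ : z₁ ∈ connecting x y n ε)
    (h₂ : z₂ ∈ connecting y w m ε) :
    splice n z₁ z₂ ∈ connecting x w (n + m) (3 * ε) ∧
      action (potential h) (n + m) (splice n z₁ z₂) ≤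
        action (potential h) n z₁ + action (potential h) m z₂ + K * (4 * ε) := by
  obtain ⟨h₁a, h₁b⟩ := h₁
  obtain ⟨h₂a, h₂b⟩ := h₂
  have hmid : dist (shift^[n] z₁) z₂ < 2 * ε :=
    (dist_triangle _ y _).trans_lt (by linarith)
  refine ⟨⟨?_, ?_⟩, ?_⟩
  · refine (dist_triangle _ z₁ _).trans_lt ?_
    rw [dist_splice]
    have : (1 / 2 : ℝ) ^ n * dist (shift^[n] z₁) z₂ ≤ dist (shift^[n] z₁) z₂ :=
      mul_le_of_le_one_left dist_nonneg (pow_le_one₀ (by norm_num) (by norm_num))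
    linarith
  · rw [add_comm n m, Function.iterate_add_apply, shift_iterate_splice]
    exact h₂b.trans_le (by linarith [dist_nonneg.trans_lt h₁a])
  · rw [action_add, shift_iterate_splice]
    have h1 := (abs_le.1 (action_splice_sub_le hK n z₁ z₂)).2
    have h2 : |(z₂ 0 : ℝ) - z₁ n| ≤ 4 * ε := by
      have := abs_coord_sub_le z₂ (shift^[n] z₁) 0
      rw [shift_iterate_apply, dist_comm] at this
      norm_num at this
      linarith
    have h3 : (K : ℝ) * |(z₂ 0 : ℝ) - z₁ n| ≤ K * (4 * ε) := by gcongr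
    linarith

/-! ### The optimal average -/

theorem LipSquare.continuous_potential {K : ℝ≥0} {h : ℝ → ℝ → ℝ} (hK : LipSquare K h) :
    Continuous (potential h) := by
  refine (LipschitzWith.of_dist_le_mul (K := K * 4) fun x y => ?_).continuous
  have h1 := hK.abs_sub_le (x 0) (x 1) (y 0) (y 1)
  have h2 : max |(x 0 : ℝ) - y 0| |(x 1 : ℝ) - y 1| ≤ 4 * dist x y := by
    refine max_le ((abs_coord_sub_le x y 0).trans ?_) ((abs_coord_sub_le x y 1).trans ?_)
    · norm_num
      linarith [dist_nonneg (x := x) (y := y)]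
    · norm_num
  rw [Real.dist_eq]
  push_cast
  rw [mul_assoc]
  exact h1.trans (by gcongr)

theorem LipSquare.abs_potential_le {K : ℝ≥0} {h : ℝ → ℝ → ℝ} (hK : LipSquare K h)
    (x : SeqSpace) : |potential h x| ≤ |h 0 0| + K := by
  have h1 := hK.abs_sub_le (x 0) (x 1) 0 0
  have h2 : max |(x 0 : ℝ) - (0 : unitInterval)| |(x 1 : ℝ) - (0 : unitInterval)| ≤ 1 := by
    simp only [Set.Icc.coe_zero, sub_zero]
    refine max_le ?_ ?_ <;>
      · rw [abs_le]
        constructor <;> linarith [(x 0).2.1, (x 0).2.2, (x 1).2.1, (x 1).2.2]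
  have h3 : (K : ℝ) * max |(x 0 : ℝ) - (0 : unitInterval)| |(x 1 : ℝ) - (0 : unitInterval)| ≤ K :=
    mul_le_of_le_one_right K.2 h2
  have h4 := abs_sub_abs_le_abs_sub (h (x 0) (x 1)) (h (0 : unitInterval) (0 : unitInterval))
  simp only [Set.Icc.coe_zero] at h1 h3 h4
  unfold potential
  linarith

theorem LipSquare.integrable_potential {K : ℝ≥0} {h : ℝ → ℝ → ℝ} (hK : LipSquare K h)
    (μ : Measure SeqSpace) [IsFiniteMeasure μ] : Integrable (potential h) μ :=
  Integrable.of_bound hK.continuous_potential.measurable.aestronglyMeasurable (|h 0 0| + K)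
    (Eventually.of_forall fun x => hK.abs_potential_le x)

theorem measurable_shift : Measurable shift := by
  refine (LipschitzWith.of_dist_le_mul (K := 2) fun x y => ?_).continuous.measurable
  have := dist_eq_head_add_shift x y
  have h0 := abs_nonneg ((x 0 : ℝ) - y 0)
  push_cast
  linarith

/-- The optimal average is at most the mean of the potential along a periodic orbit. -/
theorem nat_mul_optAverage_le {K : ℝ≥0} {h : ℝ → ℝ → ℝ} (hK : LipSquare K h) {n : ℕ}
    (hn : 1 ≤ n) {z : SeqSpace} (hz : shift^[n] z = z) :
    n * optAverage (potential h) ≤ ∑ i ∈ Finset.range n, potential h (shift^[i] z) := by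
  have hn0 : (n : ENNReal) ≠ 0 := by exact_mod_cast (by omega : n ≠ 0)
  have hnR : (0 : ℝ) < n := by exact_mod_cast hn
  set ν : Measure SeqSpace := ∑ i ∈ Finset.range n, Measure.dirac (shift^[i] z) with hν
  have hνuniv : ν Set.univ = n := by simp [hν]
  have hmap : ν.map shift = ν := by
    have hmd : ∀ y, (Measure.dirac y).map shift = Measure.dirac (shift y) :=
      fun y => Measure.map_dirac' measurable_shift y
    rw [hν, Measure.map_finset_sum measurable_shift.aemeasurable]
    simp only [hmd, ← Function.iterate_succ_apply' shift]
    have h1 := Finset.sum_range_succ (fun i => Measure.dirac (shift^[i] z)) n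
    rw [Finset.sum_range_succ', hz] at h1
    ext s hs
    have h2 := congrArg (fun m : Measure SeqSpace => m s) h1
    simp only [Measure.add_apply, Function.iterate_zero, id] at h2
    exact (ENNReal.add_left_inj (measure_ne_top _ _)).1 h2
  set μ : Measure SeqSpace := (n : ENNReal)⁻¹ • ν with hμ
  have hprob : IsProbabilityMeasure μ := ⟨by
    rw [hμ, Measure.smul_apply, hνuniv, smul_eq_mul,
      ENNReal.inv_mul_cancel hn0 (ENNReal.natCast_ne_top n)]⟩
  have hpres : MeasurePreserving shift μ μ :=
    ⟨measurable_shift, by rw [hμ, Measure.map_smul, hmap]⟩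
  have hint : ∫ x, potential h x ∂μ =
      (n : ℝ)⁻¹ * ∑ i ∈ Finset.range n, potential h (shift^[i] z) := by
    rw [hμ, integral_smul_measure, hν,
      integral_finsetSum_measure (fun i _ => hK.integrable_potential _)]
    simp
  have hle : optAverage (potential h) ≤ ∫ x, potential h x ∂μ := by
    refine csInf_le ⟨-(|h 0 0| + K), ?_⟩ ⟨μ, hprob, hpres, rfl⟩
    rintro r ⟨μ', hμ', -, rfl⟩
    have := integral_mono (μ := μ') (integrable_const (-(|h 0 0| + K)))
      (hK.integrable_potential μ') (fun x => (abs_le.1 (hK.abs_potential_le x)).1)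
    simpa using this
  rw [hint] at hle
  calc n * optAverage (potential h) ≤ n * ((n : ℝ)⁻¹ * _) := by gcongr
    _ = _ := by rw [← mul_assoc, mul_inv_cancel₀ hnR.ne', one_mul]

theorem optAverage_le_diag {K : ℝ≥0} {h : ℝ → ℝ → ℝ} (hK : LipSquare K h) (a : unitInterval) :
    optAverage (potential h) ≤ h a a := by
  simpa [potential, constSeq] using nat_mul_optAverage_le hK le_rfl (shift_iterate_constSeq a 1)

/-- Birkhoff sums bounded below by `n c - C`, uniformly, force every invariant mean to be at
least `c`. -/
theorem le_optAverage {K : ℝ≥0} {h : ℝ → ℝ → ℝ} (hK : LipSquare K h) {c C : ℝ}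
    (hc : ∀ (n : ℕ) (z : SeqSpace),
      n * c - C ≤ ∑ i ∈ Finset.range n, potential h (shift^[i] z)) :
    c ≤ optAverage (potential h) := by
  refine le_csInf ?_ ?_
  · refine ⟨_, Measure.dirac (constSeq 0), inferInstance, ⟨measurable_shift, ?_⟩, rfl⟩
    rw [Measure.map_dirac' measurable_shift]
    rfl
  · rintro r ⟨μ, hμ, hpres, rfl⟩
    have hcomp : ∀ i : ℕ, Integrable (fun x => potential h (shift^[i] x)) μ := fun i =>
      (hpres.iterate i).integrable_comp_of_integrable (hK.integrable_potential μ)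
    have hsum : ∀ n : ℕ, n * c - C ≤ n * ∫ x, potential h x ∂μ := fun n => by
      have h1 := integral_mono (μ := μ) (integrable_const (n * c - C))
        (integrable_finsetSum (Finset.range n) fun i _ => hcomp i) (fun z => hc n z)
      rw [integral_finsetSum _ fun i _ => hcomp i] at h1
      have h2 : ∀ i : ℕ, ∫ x, potential h (shift^[i] x) ∂μ = ∫ x, potential h x ∂μ := fun i => by
        have h3 := integral_map (μ := μ) (hpres.iterate i).measurable.aemeasurable
          (hK.continuous_potential.measurable.aestronglyMeasurable)
        rw [(hpres.iterate i).map_eq] at h3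
        exact h3.symm
      simpa [h2] using h1
    by_contra! hlt
    obtain ⟨n, hn⟩ := exists_nat_gt (C / (c - ∫ x, potential h x ∂μ))
    rw [div_lt_iff₀ (by linarith)] at hn
    linarith [hsum n]

/-- Closing up the first `n` entries of `z` to a periodic orbit costs at most `K |z_n - z_0|`. -/
theorem neg_le_action {K : ℝ≥0} {h : ℝ → ℝ → ℝ} (hK : LipSquare K h) (n : ℕ) (z : SeqSpace) :
    -(K * |(z n : ℝ) - z 0|) ≤ action (potential h) n z := by
  rcases Nat.eq_zero_or_pos n with rfl | hn
  · simp [action]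
  set p : SeqSpace := fun i => z (i % n) with hp
  have hper : shift^[n] p = p := by
    funext i
    rw [shift_iterate_apply]
    simp [hp]
  have hsp : splice n z p = p := by
    funext i
    by_cases hi : i < n
    · simp [splice, hi, hp, Nat.mod_eq_of_lt]
    · simp [splice, hi, hp, ← Nat.mod_eq_sub_mod (not_lt.1 hi)]
  have h1 := nat_mul_optAverage_le hK hn hper
  have h2 : 0 ≤ action (potential h) n p := by
    simp only [action, Finset.sum_sub_distrib, Finset.sum_const, Finset.card_range, nsmul_eq_mul]
    linarith
  have h3 := (abs_le.1 (action_splice_sub_le hK n z p)).2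
  rw [hsp] at h3
  have h4 : (p 0 : ℝ) = z 0 := by simp [hp]
  rw [h4, abs_sub_comm] at h3
  linarith


/-! ### Peierls' barrier and the Mañé potential through pseudo-orbits -/

theorem peierls_le_iff {φ : SeqSpace → ℝ} {x y : SeqSpace} {c : ℝ} :
    peierls φ x y ≤ c ↔
      ∀ η > 0, ∀ N : ℕ, ∃ n ≥ N, ∃ z ∈ connecting x y n η, action φ n z < c + η := by
  constructor
  · intro h η hη N
    have h1 : peierlsEps φ x y η < ((c + η : ℝ) : EReal) :=
      ((le_iSup₂_of_le (f := fun (ε : ℝ) (_ : 0 < ε) => peierlsEps φ x y ε) η hη le_rfl).trans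
        h).trans_lt (EReal.coe_lt_coe_iff.2 (by linarith))
    obtain ⟨n, hn, hlt⟩ := frequently_atTop.1 (frequently_lt_of_liminf_lt (h := h1)) N
    simp only [iInf_lt_iff, EReal.coe_lt_coe_iff] at hlt
    obtain ⟨z, hz, hlt⟩ := hlt
    exact ⟨n, hn, z, hz, hlt⟩
  · refine fun h => iSup₂_le fun ε hε => EReal.le_of_forall_lt_iff_le.1 fun r hr => ?_
    rw [EReal.coe_lt_coe_iff] at hr
    refine liminf_le_of_frequently_le' (frequently_atTop.2 fun N => ?_)
    obtain ⟨n, hn, z, hz, hlt⟩ := h (min ε (r - c)) (lt_min hε (by linarith)) N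
    refine ⟨n, hn, iInf₂_le_of_le z (connecting_mono _ _ _ (min_le_left _ _) hz) ?_⟩
    exact EReal.coe_le_coe_iff.2 (by linarith [min_le_right ε (r - c)])

theorem le_peierls {φ : SeqSpace → ℝ} {x y : SeqSpace} {c : ℝ}
    (h : ∀ η > 0, ∃ ε > 0, ∀ n, ∀ z ∈ connecting x y n ε, c - η ≤ action φ n z) :
    c ≤ peierls φ x y := by
  refine EReal.ge_of_forall_gt_iff_ge.1 fun r hr => ?_
  rw [EReal.coe_lt_coe_iff] at hr
  obtain ⟨ε, hε, hb⟩ := h (c - r) (by linarith)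
  refine le_iSup₂_of_le ε hε (le_liminf_of_le (h := Eventually.of_forall fun n => ?_))
  exact le_iInf₂ fun z hz => EReal.coe_le_coe_iff.2 (by linarith [hb n z hz])

theorem connecting_coord_zero {x y z : SeqSpace} {n : ℕ} {ε : ℝ} (hz : z ∈ connecting x y n ε) :
    |(x 0 : ℝ) - z 0| ≤ 2 * ε := by
  have := abs_coord_sub_le x z 0
  norm_num at this
  linarith [hz.1]

theorem connecting_coord_end {x y z : SeqSpace} {n : ℕ} {ε : ℝ} (hz : z ∈ connecting x y n ε) :
    |(z n : ℝ) - y 0| ≤ 2 * ε := by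
  have := abs_coord_sub_le (shift^[n] z) y 0
  rw [shift_iterate_apply] at this
  norm_num at this
  linarith [hz.2]

theorem connecting_abs_end_sub {x y z : SeqSpace} {n : ℕ} {ε : ℝ}
    (hz : z ∈ connecting x y n ε) : |(z n : ℝ) - z 0| ≤ |(x 0 : ℝ) - y 0| + 4 * ε := by
  have h1 := connecting_coord_zero hz
  have h2 := connecting_coord_end hz
  have h3 := abs_sub_le (z n : ℝ) (y 0) (z 0)
  have h4 := abs_sub_le (y 0 : ℝ) (x 0) (z 0)
  rw [abs_sub_comm (y 0 : ℝ) (x 0)] at h4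
  linarith

theorem mane_self_nonneg {K : ℝ≥0} {h : ℝ → ℝ → ℝ} (hK : LipSquare K h) (x : SeqSpace) :
    0 ≤ mane (potential h) x x := by
  refine EReal.ge_of_forall_gt_iff_ge.1 fun r hr => ?_
  replace hr : r < 0 := by exact_mod_cast hr
  refine le_iSup₂_of_le (-r / (4 * (K + 1))) (by have := neg_pos.2 hr; positivity) ?_
  refine le_iInf₂ fun n _ => le_iInf₂ fun z hz => EReal.coe_le_coe_iff.2 ?_
  refine le_trans ?_ (neg_le_action hK n z)
  have h1 := connecting_abs_end_sub hz
  rw [sub_self, abs_zero, zero_add] at h1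
  have h2 : (K : ℝ) * |(z n : ℝ) - z 0| ≤ (K + 1) * (4 * (-r / (4 * (K + 1)))) := by
    gcongr
    linarith
  have h3 : ((K : ℝ) + 1) * (4 * (-r / (4 * (K + 1)))) = -r := by
    have : (K : ℝ) + 1 ≠ 0 := by positivity
    field_simp
  linarith

theorem mem_aubrySet_iff {K : ℝ≥0} {h : ℝ → ℝ → ℝ} (hK : LipSquare K h) {x : SeqSpace} :
    x ∈ aubrySet (potential h) ↔
      ∀ η > 0, ∃ n ≥ 1, ∃ z ∈ connecting x x n η, action (potential h) n z < η := by
  constructor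
  · intro hx η hη
    have h1 : maneEps (potential h) x x η < (η : EReal) := by
      refine (le_iSup₂_of_le (f := fun (ε : ℝ) (_ : 0 < ε) => maneEps (potential h) x x ε)
        η hη le_rfl).trans_lt ?_
      change mane (potential h) x x < η
      rw [show mane (potential h) x x = 0 from hx]
      exact_mod_cast hη
    simp only [maneEps, iInf_lt_iff, EReal.coe_lt_coe_iff] at h1
    obtain ⟨n, hn, z, hz, hlt⟩ := h1
    exact ⟨n, hn, z, hz, hlt⟩
  · intro hx
    refine le_antisymm (iSup₂_le fun ε hε => ?_) (mane_self_nonneg hK x)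
    rw [← EReal.coe_zero]
    refine EReal.le_of_forall_lt_iff_le.1 fun r hr => ?_
    rw [EReal.coe_lt_coe_iff] at hr
    obtain ⟨n, hn, z, hz, hlt⟩ := hx (min ε r) (lt_min hε hr)
    refine iInf₂_le_of_le n hn
      (iInf₂_le_of_le z (connecting_mono _ _ _ (min_le_left _ _) hz) ?_)
    exact EReal.coe_le_coe_iff.2 (hlt.le.trans (min_le_right _ _))

/-! ### The pseudometric on the Aubry set -/

/-- A scale `ε ≤ η` that survives one splicing: errors `3 ε` in distance and
`2 ε + 4 K ε` in action stay below `η`. -/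
theorem exists_splice_scale (K : ℝ≥0) {η : ℝ} (hη : 0 < η) :
    ∃ ε > 0, 3 * ε ≤ η ∧ 2 * ε + K * (4 * ε) ≤ η := by
  have hK : (0 : ℝ) ≤ K := K.2
  refine ⟨η / (4 * K + 3), by positivity, ?_, ?_⟩
  · rw [mul_div_assoc', div_le_iff₀ (by positivity)]
    nlinarith
  · have : 2 * (η / (4 * K + 3)) + K * (4 * (η / (4 * K + 3))) =
        (η * (4 * K + 2)) / (4 * K + 3) := by ring
    rw [this, div_le_iff₀ (by positivity)]
    nlinarith

/-- A point of the Aubry set returns to itself after arbitrarily long times at almost no cost. -/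
theorem exists_long_return {K : ℝ≥0} {h : ℝ → ℝ → ℝ} (hK : LipSquare K h) {x : SeqSpace}
    (hx : x ∈ aubrySet (potential h)) (N : ℕ) {η : ℝ} (hη : 0 < η) :
    ∃ n ≥ N, ∃ z ∈ connecting x x n η, action (potential h) n z < η := by
  induction N generalizing η with
  | zero =>
    obtain ⟨n, -, h1⟩ := (mem_aubrySet_iff hK).1 hx η hη
    exact ⟨n, n.zero_le, h1⟩
  | succ N ih =>
    obtain ⟨ε, hε, h3, hact⟩ := exists_splice_scale K hη
    obtain ⟨n, hn, z, hz, hzlt⟩ := ih hε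
    obtain ⟨m, hm, w, hw, hwlt⟩ := (mem_aubrySet_iff hK).1 hx ε hε
    obtain ⟨hs, hsle⟩ := exists_connecting_add hK hz hw
    exact ⟨n + m, by omega, _, connecting_mono _ _ _ h3 hs, by linarith⟩

theorem peierls_le_lip {K : ℝ≥0} {h : ℝ → ℝ → ℝ} (hK : LipSquare K h) {x : SeqSpace}
    (hx : x ∈ aubrySet (potential h)) (y : SeqSpace) :
    peierls (potential h) x y ≤ (K * |(x 0 : ℝ) - y 0| : ℝ) := by
  refine peierls_le_iff.2 fun η hη N => ?_
  obtain ⟨ε, hε, h3, hact⟩ := exists_splice_scale K hη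
  obtain ⟨N', hN'⟩ := exists_pow_lt_of_lt_one hε (show (1 / 2 : ℝ) < 1 by norm_num)
  obtain ⟨n, hn, z, hz, hlt⟩ := exists_long_return hK hx (max N N') hε
  refine ⟨n, (le_max_left _ _).trans hn, splice n z y, ⟨?_, ?_⟩, ?_⟩
  · refine (dist_triangle _ z _).trans_lt ?_
    rw [dist_splice]
    have h1 : (1 / 2 : ℝ) ^ n ≤ (1 / 2) ^ N' :=
      pow_le_pow_of_le_one (by norm_num) (by norm_num) ((le_max_right _ _).trans hn)
    have h2 : (1 / 2 : ℝ) ^ n * dist (shift^[n] z) y ≤ (1 / 2) ^ n :=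
      mul_le_of_le_one_right (by positivity) (dist_le_one _ _)
    linarith [hz.1]
  · rw [shift_iterate_splice, dist_self]
    exact hη
  · have h1 := (abs_le.1 (action_splice_sub_le hK n z y)).2
    have h2 : (K : ℝ) * |(y 0 : ℝ) - z n| ≤ K * (|(x 0 : ℝ) - y 0| + 4 * ε) := by
      gcongr
      have h4 := connecting_coord_end hz
      have h5 := abs_sub_le (y 0 : ℝ) (x 0) (z n)
      rw [abs_sub_comm (y 0 : ℝ) (x 0), abs_sub_comm (x 0 : ℝ) (z n)] at h5
      linarith
    linarith

theorem neg_lip_le_peierls {K : ℝ≥0} {h : ℝ → ℝ → ℝ} (hK : LipSquare K h) (x y : SeqSpace) :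
    (-(K * |(x 0 : ℝ) - y 0|) : ℝ) ≤ peierls (potential h) x y := by
  refine le_peierls fun η hη => ?_
  obtain ⟨ε, hε, -, hact⟩ := exists_splice_scale K hη
  refine ⟨ε, hε, fun n z hz => le_trans ?_ (neg_le_action hK n z)⟩
  have : (K : ℝ) * |(z n : ℝ) - z 0| ≤ K * (|(x 0 : ℝ) - y 0| + 4 * ε) := by
    gcongr
    exact connecting_abs_end_sub hz
  linarith

theorem peierls_ne_top {K : ℝ≥0} {h : ℝ → ℝ → ℝ} (hK : LipSquare K h) {x : SeqSpace}
    (hx : x ∈ aubrySet (potential h)) (y : SeqSpace) : peierls (potential h) x y ≠ ⊤ :=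
  ((peierls_le_lip hK hx y).trans_lt (EReal.coe_lt_top _)).ne

theorem peierls_ne_bot {K : ℝ≥0} {h : ℝ → ℝ → ℝ} (hK : LipSquare K h) (x y : SeqSpace) :
    peierls (potential h) x y ≠ ⊥ :=
  ((EReal.bot_lt_coe _).trans_le (neg_lip_le_peierls hK x y)).ne'

theorem coe_toReal_peierls {K : ℝ≥0} {h : ℝ → ℝ → ℝ} (hK : LipSquare K h) {x : SeqSpace}
    (hx : x ∈ aubrySet (potential h)) (y : SeqSpace) :
    ((peierls (potential h) x y).toReal : EReal) = peierls (potential h) x y :=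
  EReal.coe_toReal (peierls_ne_top hK hx y) (peierls_ne_bot hK x y)

theorem peierls_self {K : ℝ≥0} {h : ℝ → ℝ → ℝ} (hK : LipSquare K h) {x : SeqSpace}
    (hx : x ∈ aubrySet (potential h)) : peierls (potential h) x x = 0 :=
  le_antisymm (by simpa using peierls_le_lip hK hx x) (by simpa using neg_lip_le_peierls hK x x)

theorem peierls_triangle {K : ℝ≥0} {h : ℝ → ℝ → ℝ} (hK : LipSquare K h) {x y : SeqSpace}
    (hx : x ∈ aubrySet (potential h)) (hy : y ∈ aubrySet (potential h)) (w : SeqSpace) :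
    peierls (potential h) x w ≤ peierls (potential h) x y + peierls (potential h) y w := by
  rw [← coe_toReal_peierls hK hx y, ← coe_toReal_peierls hK hy w, ← EReal.coe_add]
  refine peierls_le_iff.2 fun η hη N => ?_
  obtain ⟨ε, hε, h3, hact⟩ := exists_splice_scale K hη
  obtain ⟨n, hn, z₁, hz₁, hlt₁⟩ := peierls_le_iff.1 (coe_toReal_peierls hK hx y).ge ε hε N
  obtain ⟨m, -, z₂, hz₂, hlt₂⟩ := peierls_le_iff.1 (coe_toReal_peierls hK hy w).ge ε hε 0
  obtain ⟨hs, hsle⟩ := exists_connecting_add hK hz₁ hz₂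
  exact ⟨n + m, by omega, _, connecting_mono _ _ _ h3 hs, by linarith⟩

theorem isFinitePseudoMetric_aubryDelta {K : ℝ≥0} {h : ℝ → ℝ → ℝ} (hK : LipSquare K h) :
    IsFinitePseudoMetric (aubryDelta (potential h)) where
  ne_top x y := (EReal.add_lt_top (peierls_ne_top hK x.2 y) (peierls_ne_top hK y.2 x)).ne
  ne_bot x y := by
    rw [aubryDelta, Ne, EReal.add_eq_bot_iff]
    exact not_or.2 ⟨peierls_ne_bot hK x y, peierls_ne_bot hK y x⟩
  self x := by rw [aubryDelta, peierls_self hK x.2, add_zero]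
  comm x y := add_comm _ _
  triangle x y w := by
    refine (add_le_add (peierls_triangle hK x.2 y.2 w) (peierls_triangle hK w.2 y.2 x)).trans
      (le_of_eq ?_)
    simp only [aubryDelta]
    abel

/-! ### Potentials whose action controls the oscillation -/

/-- Up to a boundary term, the action (normalised by `h^*`) of every orbit segment is bounded below
by the sum of a local excess `q`. For closed segments this says that they cost at least the total
excess. -/
def HasExcess (h q : ℝ → ℝ → ℝ) (L : ℝ≥0) : Prop :=
  ∀ (n : ℕ) (z : SeqSpace),
    ∑ i ∈ Finset.range n, q (z i) (z (i + 1)) - L * |(z n : ℝ) - z 0| ≤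
      ∑ i ∈ Finset.range n, (h (z i) (z (i + 1)) - diagMin h)

theorem diagMin_le {K : ℝ≥0} {h : ℝ → ℝ → ℝ} (hK : LipSquare K h) (a : unitInterval) :
    diagMin h ≤ h a a := by
  refine csInf_le ⟨h 0 0 - K, ?_⟩ ⟨a, a.2, rfl⟩
  rintro _ ⟨x, hx, rfl⟩
  have := (abs_le.1 (hK.abs_potential_le (constSeq ⟨x, hx⟩))).1
  have h1 := (abs_le.1 (hK.abs_sub_le ⟨x, hx⟩ ⟨x, hx⟩ 0 0)).1
  have h2 : (K : ℝ) * |x| ≤ K := mul_le_of_le_one_right K.2 (by rw [abs_of_nonneg hx.1]; exact hx.2)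
  simp only [Set.Icc.coe_zero, sub_zero, max_self] at h1
  linarith

theorem excess_nonneg {K : ℝ≥0} {h q : ℝ → ℝ → ℝ} (hK : LipSquare K h) {c : ℝ} (hc : 0 < c)
    (hqc : ∀ s t : unitInterval, h s s - diagMin h + c * ((s : ℝ) - t) ^ 2 ≤ q s t)
    (s t : unitInterval) : 0 ≤ q s t := by
  have := hqc s t
  have := diagMin_le hK s
  have : 0 ≤ c * ((s : ℝ) - t) ^ 2 := by positivity
  linarith

theorem HasExcess.optAverage_eq {K : ℝ≥0} {h q : ℝ → ℝ → ℝ} (hK : LipSquare K h) {L : ℝ≥0}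
    (hq : HasExcess h q L) (hq0 : ∀ s t : unitInterval, 0 ≤ q s t) :
    optAverage (potential h) = diagMin h := by
  refine le_antisymm (le_csInf ((nonempty_Icc.2 zero_le_one).image _) ?_)
    (le_optAverage hK (C := L) fun n z => ?_)
  · rintro _ ⟨x, hx, rfl⟩
    exact optAverage_le_diag hK ⟨x, hx⟩
  · have h1 := hq n z
    have h2 : 0 ≤ ∑ i ∈ Finset.range n, q (z i) (z (i + 1)) :=
      Finset.sum_nonneg fun i _ => hq0 _ _
    have h3 : (L : ℝ) * |(z n : ℝ) - z 0| ≤ L := by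
      refine mul_le_of_le_one_right L.2 ?_
      rw [abs_le]
      constructor <;> linarith [(z n).2.1, (z n).2.2, (z 0).2.1, (z 0).2.2]
    simp only [Finset.sum_sub_distrib, Finset.sum_const, Finset.card_range, nsmul_eq_mul] at h1
    simp only [potential_shift_iterate]
    linarith

theorem HasExcess.le_action {K : ℝ≥0} {h q : ℝ → ℝ → ℝ} (hK : LipSquare K h) {L : ℝ≥0}
    (hq : HasExcess h q L) (hq0 : ∀ s t : unitInterval, 0 ≤ q s t) (n : ℕ) (z : SeqSpace) :
    ∑ i ∈ Finset.range n, q (z i) (z (i + 1)) - L * |(z n : ℝ) - z 0| ≤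
      action (potential h) n z := by
  rw [action_potential, hq.optAverage_eq hK hq0]
  exact hq n z

/-- Along almost closed segments of almost zero action every single excess is small. -/
theorem HasExcess.excess_le {K : ℝ≥0} {h q : ℝ → ℝ → ℝ} (hK : LipSquare K h) {L : ℝ≥0}
    (hq : HasExcess h q L) (hq0 : ∀ s t : unitInterval, 0 ≤ q s t) {x z : SeqSpace} {n : ℕ}
    {ε : ℝ} (hz : z ∈ connecting x x n ε) {i : ℕ} (hi : i < n) :
    q (z i) (z (i + 1)) ≤ action (potential h) n z + L * (4 * ε) := by
  have h1 := hq.le_action hK hq0 n z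
  have h2 := connecting_abs_end_sub hz
  rw [sub_self, abs_zero, zero_add] at h2
  have h3 : (L : ℝ) * |(z n : ℝ) - z 0| ≤ L * (4 * ε) := by gcongr
  have h4 : q (z i) (z (i + 1)) ≤ ∑ i ∈ Finset.range n, q (z i) (z (i + 1)) :=
    Finset.single_le_sum (f := fun i => q (z i) (z (i + 1)))
      (fun j _ => hq0 (z j) (z (j + 1))) (Finset.mem_range.2 hi)
  linarith

theorem constSeq_mem_aubrySet {K : ℝ≥0} {h : ℝ → ℝ → ℝ} (hK : LipSquare K h)
    {a : unitInterval} (ha : optAverage (potential h) = h a a) :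
    constSeq a ∈ aubrySet (potential h) := by
  refine (mem_aubrySet_iff hK).2 fun η hη => ⟨1, le_rfl, constSeq a, ⟨?_, ?_⟩, ?_⟩
  · rwa [dist_self]
  · rwa [shift_iterate_constSeq, dist_self]
  · simpa [action_potential, ha, constSeq] using hη

theorem HasExcess.mem_aubrySet_iff {K : ℝ≥0} {h q : ℝ → ℝ → ℝ} (hK : LipSquare K h) {L : ℝ≥0}
    (hq : HasExcess h q L) {c : ℝ} (hc : 0 < c)
    (hqc : ∀ s t : unitInterval, h s s - diagMin h + c * ((s : ℝ) - t) ^ 2 ≤ q s t)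
    {x : SeqSpace} :
    x ∈ aubrySet (potential h) ↔ ∃ a : unitInterval, (a : ℝ) ∈ minSet h ∧ x = constSeq a := by
  have hq0 := excess_nonneg hK hc hqc
  constructor
  · intro hx
    have key : ∀ i : ℕ, h (x i) (x i) - diagMin h + c * ((x i : ℝ) - x (i + 1)) ^ 2 ≤ 0 := by
      intro i
      -- pass to the limit in the bound on the `i`-th excess along closer and closer returns
      have hex : ∀ k : ℕ, ∃ n ≥ i + 1, ∃ z ∈ connecting x x n (1 / (k + 1 : ℝ)),
          action (potential h) n z < 1 / (k + 1 : ℝ) :=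
        fun k => exists_long_return hK hx (i + 1) (by positivity)
      choose n hn z hz hlt using hex
      have hε : Tendsto (fun k : ℕ => 1 / (k + 1 : ℝ)) atTop (𝓝 0) :=
        tendsto_one_div_add_atTop_nhds_zero_nat
      have hcoord : ∀ j, Tendsto (fun k => z k j) atTop (𝓝 (x j)) := fun j => by
        refine tendsto_iff_dist_tendsto_zero.2 (squeeze_zero (fun _ => dist_nonneg) (fun k => ?_)
          (g := fun k : ℕ => 2 ^ (j + 1) * (1 / (k + 1 : ℝ)))
          (by simpa using hε.const_mul (2 ^ (j + 1))))
        have h1 := abs_coord_sub_le (z k) x j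
        rw [dist_comm] at h1
        exact h1.trans (by gcongr; exact (hz k).1.le)
      have hdiag : Tendsto (fun k => h (z k i) (z k i)) atTop (𝓝 (h (x i) (x i))) := by
        have h0 : Tendsto (fun k => (K : ℝ) * |(z k i : ℝ) - x i|) atTop (𝓝 0) := by
          have := (tendsto_iff_dist_tendsto_zero.1 (hcoord i)).const_mul (K : ℝ)
          rwa [mul_zero] at this
        refine tendsto_iff_dist_tendsto_zero.2 (squeeze_zero (fun _ => dist_nonneg)
          (fun k => ?_) h0)
        rw [Real.dist_eq]
        simpa using hK.abs_sub_le (z k i) (z k i) (x i) (x i)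
      have hsq : Tendsto (fun k => c * ((z k i : ℝ) - z k (i + 1)) ^ 2) atTop
          (𝓝 (c * ((x i : ℝ) - x (i + 1)) ^ 2)) :=
        ((((continuous_subtype_val.tendsto _).comp (hcoord i)).sub
          ((continuous_subtype_val.tendsto _).comp (hcoord (i + 1)))).pow 2).const_mul c
      have hR : Tendsto (fun k : ℕ => 1 / (k + 1 : ℝ) + L * (4 * (1 / (k + 1 : ℝ)))) atTop
          (𝓝 0) := by
        simpa using hε.add ((hε.const_mul 4).const_mul (L : ℝ))
      refine le_of_tendsto_of_tendsto' ((hdiag.sub_const _).add hsq) hR fun k => ?_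
      exact (hqc _ _).trans ((hq.excess_le hK hq0 (hz k) (hn k)).trans
        (by linarith [hlt k]))
    have hstep : ∀ i, x (i + 1) = x i := fun i => by
      have h1 := key i
      have h2 := diagMin_le hK (x i)
      have h3 : ((x i : ℝ) - x (i + 1)) ^ 2 = 0 :=
        le_antisymm (by by_contra! h4; have := mul_pos hc h4; linarith) (sq_nonneg _)
      have h4 : (x i : ℝ) - x (i + 1) = 0 := by simpa using h3
      exact Subtype.ext (by linarith)
    have hconst : x = constSeq (x 0) := by
      funext i
      induction i with
      | zero => rfl
      | succ i ih => exact (hstep i).trans ih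
    refine ⟨x 0, ⟨(x 0).2, le_antisymm ?_ (diagMin_le hK (x 0))⟩, hconst⟩
    have h1 := key 0
    have : 0 ≤ c * ((x 0 : ℝ) - x (0 + 1)) ^ 2 := by positivity
    linarith
  · rintro ⟨a, ha, rfl⟩
    exact constSeq_mem_aubrySet hK ((hq.optAverage_eq hK hq0).trans ha.2.symm)

/-- One jump from `a` to `b` connects the two fixed points. -/
theorem peierls_constSeq_le {h : ℝ → ℝ → ℝ} {a : unitInterval}
    (ha : optAverage (potential h) = h a a) (b : unitInterval) :
    peierls (potential h) (constSeq a) (constSeq b) ≤ (h a b - h a a : ℝ) := by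
  refine peierls_le_iff.2 fun η hη N => ?_
  obtain ⟨N', hN'⟩ := exists_pow_lt_of_lt_one hη (show (1 / 2 : ℝ) < 1 by norm_num)
  refine ⟨max N N' + 1, by omega, splice (max N N' + 1) (constSeq a) (constSeq b), ⟨?_, ?_⟩, ?_⟩
  · rw [dist_splice]
    refine lt_of_le_of_lt (mul_le_of_le_one_right (by positivity) (dist_le_one _ _)) ?_
    exact (pow_le_pow_of_le_one (by norm_num) (by norm_num) (by omega)).trans_lt hN'
  · rwa [shift_iterate_splice, dist_self]
  · rw [action_succ_splice, action_potential]
    simp [ha, constSeq, hη]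


/-! ### Submodular functions and the rearrangement inequality -/

/-- `g` is submodular on the unit square: pairing large with large and small with small does not
cost more than mixing. -/
def IsSubmodular (g : ℝ → ℝ → ℝ) : Prop :=
  ∀ x x' y y' : unitInterval, x ≤ x' → y ≤ y' → g x' y' + g x y ≤ g x y' + g x' y

open Equiv Finset in
/-- **Rearrangement inequality** for a submodular cost: among all permutations, the identity is
cheapest. As in the proof for products, the largest entry is made a fixed point and removed. -/
theorem IsSubmodular.sum_diag_le_sum_perm {g : ℝ → ℝ → ℝ} (hg : IsSubmodular g) {ι : Type*}
    (s : Finset ι) (f : ι → unitInterval) (σ : Perm ι) (hσ : {x | σ x ≠ x} ⊆ s) :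
    ∑ i ∈ s, g (f i) (f i) ≤ ∑ i ∈ s, g (f i) (f (σ i)) := by
  classical
  induction s using induction_on_max_value f generalizing σ with
  | empty => simp only [le_rfl, Finset.sum_empty]
  | insert a s has hamax hind => ?_
  set τ : Perm ι := σ.trans (swap a (σ a)) with hτ
  have hτs : {x | τ x ≠ x} ⊆ s := by
    intro x hx
    simp only [τ, Ne, Set.mem_ofPred_eq, Equiv.swap_comp_apply] at hx
    split_ifs at hx with h₁ h₂
    · obtain rfl | hax := eq_or_ne x a
      · contradiction
      · exact mem_of_mem_insert_of_ne (hσ fun h ↦ hax <| h.symm.trans h₁) hax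
    · exact (hx <| σ.injective h₂.symm).elim
    · exact mem_of_mem_insert_of_ne (hσ hx) (ne_of_apply_ne _ h₂)
  specialize hind τ hτs
  simp_rw [sum_insert has]
  grw [hind]
  obtain hσa | hσa := eq_or_ne a (σ a)
  · rw [hτ, ← hσa, swap_self, trans_refl]
  have h1s : σ.symm a ∈ s := by
    rw [Ne, ← Perm.inv_eq_iff_eq] at hσa
    refine mem_of_mem_insert_of_ne (hσ fun h ↦ hσa ?_) hσa
    rwa [apply_symm_apply, eq_comm] at h
  have h2s : σ a ∈ s := mem_of_mem_insert_of_ne (hσ <| σ.injective.ne hσa.symm) hσa.symm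
  simp only [← s.sum_erase_add _ h1s, add_comm]
  rw [← add_assoc, ← add_assoc]
  simp only [hτ, swap_apply_left, Equiv.coe_trans, Function.comp_apply, apply_symm_apply]
  refine add_le_add ?_ (sum_congr rfl fun x hx ↦ ?_).le
  · have := hg (f (σ.symm a)) (f a) (f (σ a)) (f a) (hamax _ h1s) (hamax _ h2s)
    linarith
  · rw [mem_erase, Ne, eq_symm_apply] at hx
    rw [swap_apply_of_ne_of_ne hx.1 (σ.injective.ne _)]
    rintro rfl
    exact has hx.2

/-- A closed chain costs at least as much as staying at each of its points once. -/
theorem IsSubmodular.sum_diag_le_sum_cycle {g : ℝ → ℝ → ℝ} (hg : IsSubmodular g) (n : ℕ)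
    (z : ℕ → unitInterval) :
    ∑ i ∈ Finset.range (n + 1), g (z i) (z i) ≤
      ∑ i ∈ Finset.range n, g (z i) (z (i + 1)) + g (z n) (z 0) := by
  have h1 := hg.sum_diag_le_sum_perm Finset.univ (fun i : Fin (n + 1) => z i)
    (finRotate (n + 1)) (by simp)
  rw [Fin.sum_univ_castSucc (fun i => g (z i) (z (finRotate (n + 1) i)))] at h1
  simp only [finRotate_apply, Fin.coeSucc_eq_succ, Fin.val_last,
    Fin.val_castSucc, Fin.val_succ, Fin.val_zero, Fin.last_add_one] at h1
  rw [← Fin.sum_univ_eq_sum_range (fun i => g (z i) (z i)),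
    ← Fin.sum_univ_eq_sum_range (fun i => g (z i) (z (i + 1)))]
  exact h1

/-- If `h + c x y` is submodular, then, since `c (x² - x y) = c (x - y)² / 2` up to a telescoping
term, jumps are penalised quadratically. -/
theorem hasExcess_of_isSubmodular {K : ℝ≥0} {h : ℝ → ℝ → ℝ} (hK : LipSquare K h) {c : ℝ≥0}
    (hsub : IsSubmodular fun x y => h x y + c * (x * y)) :
    HasExcess h (fun s t => h s s - diagMin h + c / 2 * (s - t) ^ 2) (K + 2 * c) := by
  intro n z
  cases n with
  | zero => simp
  | succ m =>
    have h1 := hsub.sum_diag_le_sum_cycle m z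
    beta_reduce at h1
    have h2 : ∑ i ∈ Finset.range m, (h (z i) (z (i + 1)) + c * ((z i : ℝ) * z (i + 1))) +
        (h (z m) (z 0) + c * ((z m : ℝ) * z 0)) ≤
        ∑ i ∈ Finset.range (m + 1), (h (z i) (z (i + 1)) + c * ((z i : ℝ) * z (i + 1))) +
          (K + c) * |(z (m + 1) : ℝ) - z 0| := by
      rw [Finset.sum_range_succ]
      have h3 := (abs_le.1 (hK.abs_sub_le_right (z m) (z (m + 1)) (z 0))).1
      have h4 : (z m : ℝ) * (z 0 - z (m + 1)) ≤ |(z (m + 1) : ℝ) - z 0| := by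
        rw [abs_sub_comm]
        calc (z m : ℝ) * (z 0 - z (m + 1)) ≤ z m * |(z 0 : ℝ) - z (m + 1)| :=
              mul_le_mul_of_nonneg_left (le_abs_self _) (z m).2.1
          _ ≤ _ := mul_le_of_le_one_left (abs_nonneg _) (z m).2.2
      have h5 := mul_le_mul_of_nonneg_left h4 c.coe_nonneg
      linarith
    have h6 : ∑ i ∈ Finset.range (m + 1),
        (c * ((z i : ℝ) * z i) - c * ((z i : ℝ) * z (i + 1)) - c / 2 * ((z i : ℝ) - z (i + 1)) ^ 2)
        = c / 2 * ((z 0 : ℝ) ^ 2 - (z (m + 1) : ℝ) ^ 2) := by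
      rw [← Finset.sum_range_sub' (fun i => (z i : ℝ) ^ 2), Finset.mul_sum]
      exact Finset.sum_congr rfl fun i _ => by ring
    have h7 : -(c * |(z (m + 1) : ℝ) - z 0|) ≤ c / 2 * ((z 0 : ℝ) ^ 2 - (z (m + 1) : ℝ) ^ 2) := by
      have h8 : ((z (m + 1) : ℝ) - z 0) * ((z (m + 1) : ℝ) + z 0) ≤
          |(z (m + 1) : ℝ) - z 0| * 2 := by
        have h9 : 0 ≤ (z (m + 1) : ℝ) + z 0 := add_nonneg (z (m + 1)).2.1 (z 0).2.1
        have h10 : (z (m + 1) : ℝ) + z 0 ≤ 2 := by linarith [(z (m + 1)).2.2, (z 0).2.2]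
        gcongr
        exact le_abs_self _
      have h11 := mul_le_mul_of_nonneg_left h8 (show (0 : ℝ) ≤ c / 2 by positivity)
      linarith
    simp only [Finset.sum_add_distrib, Finset.sum_sub_distrib] at h1 h2 h6 ⊢
    push_cast
    linarith

/-! ### The twist condition -/

/-- A nonpositive mixed derivative makes a function submodular. -/
theorem isSubmodular_of_mixed_deriv_nonpos {g g₁ g₁₂ : ℝ → ℝ → ℝ}
    (h₁ : ∀ x ∈ Icc (0 : ℝ) 1, ∀ y ∈ Icc (0 : ℝ) 1,
      HasDerivWithinAt (fun t => g t y) (g₁ x y) (Icc 0 1) x)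
    (h₁₂ : ∀ x ∈ Icc (0 : ℝ) 1, ∀ y ∈ Icc (0 : ℝ) 1,
      HasDerivWithinAt (fun s => g₁ x s) (g₁₂ x y) (Icc 0 1) y)
    (hneg : ∀ x ∈ Icc (0 : ℝ) 1, ∀ y ∈ Icc (0 : ℝ) 1, g₁₂ x y ≤ 0) : IsSubmodular g := by
  have anti : ∀ {f f' : ℝ → ℝ}, (∀ x ∈ Icc (0 : ℝ) 1, HasDerivWithinAt f (f' x) (Icc 0 1) x) →
      (∀ x ∈ Icc (0 : ℝ) 1, f' x ≤ 0) → AntitoneOn f (Icc 0 1) := fun hf hf' =>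
    antitoneOn_of_hasDerivWithinAt_nonpos (convex_Icc 0 1)
      (fun x hx => (hf x hx).continuousWithinAt)
      (fun x hx => (hf x (interior_subset hx)).mono interior_subset)
      (fun x hx => hf' x (interior_subset hx))
  intro x x' y y' hx hy
  have hd : AntitoneOn (fun t => g t y' - g t y) (Icc 0 1) :=
    anti (fun t ht => (h₁ t ht y' y'.2).sub (h₁ t ht y y.2))
      fun t ht => sub_nonpos.2 (anti (h₁₂ t ht) (hneg t ht) y.2 y'.2 hy)
  have := hd x.2 x'.2 hx
  simp only at this
  linarith

/-- By compactness the twist condition is uniform: the mixed derivative lies in a compact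
subinterval of the negative half-line. -/
theorem IsTwist.exists_isSubmodular {h : ℝ → ℝ → ℝ} (hh : IsTwist h) :
    ∃ c C : ℝ≥0, 0 < c ∧ IsSubmodular (fun x y => h x y + c * (x * y)) ∧
      IsSubmodular (fun x y => -h x y - C * (x * y)) := by
  set S : Set (ℝ × ℝ) := Icc (0 : ℝ) 1 ×ˢ Icc (0 : ℝ) 1 with hS
  set F : ℝ × ℝ → ℝ := fun p => h p.1 p.2 with hF
  set F₁ : ℝ × ℝ → ℝ := fun p => fderivWithin ℝ F S p (1, 0) with hF₁
  set F₁₂ : ℝ × ℝ → ℝ := fun p => fderivWithin ℝ F₁ S p (0, 1) with hF₁₂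
  have hu : UniqueDiffOn ℝ (Icc (0 : ℝ) 1) := uniqueDiffOn_Icc zero_lt_one
  have hU : UniqueDiffOn ℝ S := hu.prod hu
  have hF₁c : ContDiffOn ℝ 1 F₁ S :=
    (hh.contDiffOn.fderivWithin hU (m := 1) (by norm_num)).clm_apply contDiffOn_const
  have hF₁₂c : ContinuousOn F₁₂ S :=
    (hF₁c.continuousOn_fderivWithin hU le_rfl).clm_apply continuousOn_const
  have hd₁ : ∀ x ∈ Icc (0 : ℝ) 1, ∀ y ∈ Icc (0 : ℝ) 1,
      HasDerivWithinAt (fun t => h t y) (F₁ (x, y)) (Icc 0 1) x := fun x hx y hy =>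
    HasFDerivWithinAt.comp_hasDerivWithinAt (l := F) (f := fun t => (t, y)) (t := S) x
      ((hh.contDiffOn.differentiableOn (by norm_num) (x, y) ⟨hx, hy⟩).hasFDerivWithinAt)
      ((hasDerivWithinAt_id x _).prodMk (hasDerivWithinAt_const x _ y)) (fun t ht => ⟨ht, hy⟩)
  have hd₁₂ : ∀ x ∈ Icc (0 : ℝ) 1, ∀ y ∈ Icc (0 : ℝ) 1,
      HasDerivWithinAt (fun s => F₁ (x, s)) (F₁₂ (x, y)) (Icc 0 1) y := fun x hx y hy =>
    HasFDerivWithinAt.comp_hasDerivWithinAt (l := F₁) (f := fun s => (x, s)) (t := S) y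
      ((hF₁c.differentiableOn (by norm_num) (x, y) ⟨hx, hy⟩).hasFDerivWithinAt)
      ((hasDerivWithinAt_const y _ x).prodMk (hasDerivWithinAt_id y _)) (fun t ht => ⟨hx, ht⟩)
  have hneg : ∀ p ∈ S, F₁₂ p < 0 := by
    rintro ⟨x, y⟩ ⟨hx, hy⟩
    have h1 := hh.twist x hx y hy
    have h2 : derivWithin (fun s => derivWithin (fun t => h t s) (Icc 0 1) x) (Icc 0 1) y =
        derivWithin (fun s => F₁ (x, s)) (Icc 0 1) y :=
      derivWithin_congr (fun s hs => (hd₁ x hx s hs).derivWithin (hu x hx))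
        ((hd₁ x hx y hy).derivWithin (hu x hx))
    rwa [h2, (hd₁₂ x hx y hy).derivWithin (hu y hy)] at h1
  have hcomp : IsCompact S := isCompact_Icc.prod isCompact_Icc
  have hne : S.Nonempty := ⟨(0, 0), by simp [hS]⟩
  obtain ⟨p, hp, hpmax⟩ := hcomp.exists_isMaxOn hne hF₁₂c
  obtain ⟨r, hr, hrmin⟩ := hcomp.exists_isMinOn hne hF₁₂c
  refine ⟨⟨-F₁₂ p, by linarith [hneg p hp]⟩, ⟨-F₁₂ r, by linarith [hneg r hr]⟩, ?_, ?_, ?_⟩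
  · exact neg_pos.2 (hneg p hp)
  · refine isSubmodular_of_mixed_deriv_nonpos (g₁ := fun x y => F₁ (x, y) + -F₁₂ p * y)
      (g₁₂ := fun x y => F₁₂ (x, y) + -F₁₂ p) (fun x hx y hy => ?_) (fun x hx y hy => ?_)
      fun x hx y hy => ?_
    · have := (hd₁ x hx y hy).add
        (((hasDerivWithinAt_id x (Icc (0 : ℝ) 1)).mul_const y).const_mul (-F₁₂ p))
      rw [one_mul] at this
      exact this
    · have := (hd₁₂ x hx y hy).add ((hasDerivWithinAt_id y (Icc (0 : ℝ) 1)).const_mul (-F₁₂ p))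
      rw [mul_one] at this
      exact this
    · have : F₁₂ (x, y) ≤ F₁₂ p := hpmax ⟨hx, hy⟩
      linarith
  · refine isSubmodular_of_mixed_deriv_nonpos (g₁ := fun x y => -F₁ (x, y) - -F₁₂ r * y)
      (g₁₂ := fun x y => -F₁₂ (x, y) - -F₁₂ r) (fun x hx y hy => ?_) (fun x hx y hy => ?_)
      fun x hx y hy => ?_
    · have := (hd₁ x hx y hy).neg.sub
        (((hasDerivWithinAt_id x (Icc (0 : ℝ) 1)).mul_const y).const_mul (-F₁₂ r))
      rw [one_mul] at this
      exact this
    · have := (hd₁₂ x hx y hy).neg.sub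
        ((hasDerivWithinAt_id y (Icc (0 : ℝ) 1)).const_mul (-F₁₂ r))
      rw [mul_one] at this
      exact this
    · have : F₁₂ r ≤ F₁₂ (x, y) := hrmin ⟨hx, hy⟩
      linarith

/-- Going from `a` to `b` and back costs `O(|a - b|²)` more than resting at the two points. -/
theorem round_trip_le_of_isSubmodular {h : ℝ → ℝ → ℝ} {C : ℝ}
    (hC : IsSubmodular fun x y => -h x y - C * (x * y)) (a b : unitInterval) :
    h a b - h a a + (h b a - h b b) ≤ C * |(a : ℝ) - b| ^ 2 := by
  rw [sq_abs]
  rcases le_total a b with hab | hab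
  · have := hC a b a b hab hab
    simp only at this
    linarith
  · have := hC b a b a hab hab
    simp only at this
    linarith


/-! ### The isometry between the minimal set and the Aubry set -/

theorem exists_isometryEquiv_of_mem_iff {h : ℝ → ℝ → ℝ}
    (hmem : ∀ x : SeqSpace, x ∈ aubrySet (potential h) ↔
      ∃ a : unitInterval, (a : ℝ) ∈ minSet h ∧ x = constSeq a) :
    ∃ ξ : minSet h ≃ᵢ aubrySet (potential h), ∀ a : minSet h, IsConstSeq a (ξ a) := by
  let e : minSet h → aubrySet (potential h) := fun a =>
    ⟨constSeq ⟨a, a.2.1⟩, (hmem _).2 ⟨_, a.2, rfl⟩⟩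
  have hiso : Isometry e := Isometry.of_dist_eq fun a b => dist_constSeq _ _
  have hsurj : Function.Surjective e := by
    rintro ⟨x, hx⟩
    obtain ⟨a, ha, rfl⟩ := (hmem x).1 hx
    exact ⟨⟨a, ha⟩, rfl⟩
  exact ⟨⟨Equiv.ofBijective e ⟨hiso.injective, hsurj⟩, hiso⟩, fun a i => rfl⟩

/-! ### The distance between fixed points in the quotient -/

theorem dist_proj_constSeq_le {h : ℝ → ℝ → ℝ}
    (hδ : IsFinitePseudoMetric (aubryDelta (potential h))) {a b : unitInterval}
    (ha : constSeq a ∈ aubrySet (potential h)) (hb : constSeq b ∈ aubrySet (potential h))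
    (ha' : optAverage (potential h) = h a a) (hb' : optAverage (potential h) = h b b) :
    dist (QuotientAubry.proj _ hδ ⟨_, ha⟩) (QuotientAubry.proj _ hδ ⟨_, hb⟩) ≤
      h a b - h a a + (h b a - h b b) := by
  rw [← EReal.coe_le_coe_iff, quotientAubry_dist, EReal.coe_add]
  exact add_le_add (peierls_constSeq_le ha' b) (peierls_constSeq_le hb' a)

/-- Cutting an interval into `n` equal steps. -/
theorem dist_le_mul_of_equal_steps {M : Type*} [PseudoMetricSpace M] {a b : ℝ} (hab : a ≤ b)
    {f : Icc a b → M} {e : ℝ → ℝ}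
    (hf : ∀ s t : Icc a b, (s : ℝ) ≤ t → dist (f s) (f t) ≤ e (t - s)) {n : ℕ} (hn : 1 ≤ n) :
    dist (f ⟨a, left_mem_Icc.2 hab⟩) (f ⟨b, right_mem_Icc.2 hab⟩) ≤ n * e ((b - a) / n) := by
  have hn0 : (0 : ℝ) < n := by exact_mod_cast hn
  set p : ℕ → ℝ := fun i => a + i * ((b - a) / n) with hp
  have hstep : 0 ≤ (b - a) / n := div_nonneg (sub_nonneg.2 hab) hn0.le
  have hpn : p n = b := by
    simp only [hp]
    field_simp
    ring
  have hmono : Monotone p := fun i j hij => by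
    simp only [hp]
    gcongr
  have hp0 : p 0 = a := by simp [hp]
  have hmem : ∀ i ≤ n, p i ∈ Icc a b := fun i hi =>
    ⟨hp0 ▸ hmono i.zero_le, hpn ▸ hmono hi⟩
  have h1 := dist_le_range_sum_dist (fun i => f (projIcc a b hab (p i))) n
  simp only [hp0, hpn, projIcc_left, projIcc_right] at h1
  refine h1.trans ((Finset.sum_le_card_nsmul _ _ (e ((b - a) / n)) fun i hi => ?_).trans_eq
    (by simp))
  have hi' := Finset.mem_range.1 hi
  rw [projIcc_of_mem hab (hmem i hi'.le), projIcc_of_mem hab (hmem (i + 1) hi')]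
  refine (hf _ _ (hmono i.le_succ)).trans_eq ?_
  congr 1
  simp only [hp]
  push_cast
  ring

/-! ### Twist potentials: the quotient identifies exactly the components -/

theorem exists_crossing {u : ℕ → ℝ} {t : ℝ} {n : ℕ} (h0 : u 0 ≤ t) (hn : t < u n) :
    ∃ i < n, u i ≤ t ∧ t < u (i + 1) := by
  induction n with
  | zero => exact absurd hn (not_lt.2 h0)
  | succ n ih =>
    rcases le_or_gt (u n) t with hle | hlt
    · exact ⟨n, n.lt_succ_self, hle, hn⟩
    · obtain ⟨i, hi, h⟩ := ih hlt
      exact ⟨i, by omega, h⟩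

/-- If a round trip between the fixed points `a` and `b` is free, then every `t` between them is
minimal: an almost free round trip makes only small jumps and stays close to the minimal set, so it
passes close to `t` while the diagonal excess is small there. -/
theorem HasExcess.Icc_subset_minSet {K : ℝ≥0} {h q : ℝ → ℝ → ℝ} (hK : LipSquare K h) {L : ℝ≥0}
    (hq : HasExcess h q L) {c : ℝ} (hc : 0 < c)
    (hqc : ∀ s t : unitInterval, h s s - diagMin h + c * ((s : ℝ) - t) ^ 2 ≤ q s t)
    {a b : unitInterval} (ha : (a : ℝ) ∈ minSet h) (hb : (b : ℝ) ∈ minSet h)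
    (hδ : peierls (potential h) (constSeq a) (constSeq b) +
      peierls (potential h) (constSeq b) (constSeq a) = 0) : Icc (a : ℝ) b ⊆ minSet h := by
  rintro t ⟨hat, htb⟩
  rcases hat.eq_or_lt with rfl | hat
  · exact ha
  rcases htb.eq_or_lt with rfl | htb
  · exact hb
  have ht : t ∈ Icc (0 : ℝ) 1 := ⟨a.2.1.trans hat.le, htb.le.trans b.2.2⟩
  refine ⟨ht, le_antisymm ?_ (diagMin_le hK ⟨t, ht⟩)⟩
  have hq0 := excess_nonneg hK hc hqc
  have haub := fun (d : unitInterval) (hd : (d : ℝ) ∈ minSet h) =>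
    (hq.mem_aubrySet_iff hK hc hqc).2 ⟨d, hd, rfl⟩
  have hAB := coe_toReal_peierls hK (haub a ha) (constSeq b)
  have hBA := coe_toReal_peierls hK (haub b hb) (constSeq a)
  have hsum : (peierls (potential h) (constSeq a) (constSeq b)).toReal +
      (peierls (potential h) (constSeq b) (constSeq a)).toReal = 0 := by
    rw [← hAB, ← hBA] at hδ
    exact_mod_cast hδ
  set M : ℝ := 2 + K * 4 + L * 12 with hM
  have hlim : Tendsto (fun ε : ℝ => diagMin h + M * ε + K * √(M * ε / c)) (𝓝[>] 0)
      (𝓝 (diagMin h)) := by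
    have : Continuous fun ε : ℝ => diagMin h + M * ε + K * √(M * ε / c) := by fun_prop
    have h0 := this.tendsto 0
    simp only [mul_zero, zero_div, Real.sqrt_zero, add_zero] at h0
    exact h0.mono_left nhdsWithin_le_nhds
  refine ge_of_tendsto hlim ?_
  have hsmall : 0 < min ((t - a) / 6) ((b - t) / 2) :=
    lt_min (by linarith) (by linarith)
  filter_upwards [Ioo_mem_nhdsGT hsmall] with ε hε
  obtain ⟨hε0, hε1⟩ := hε
  rw [lt_min_iff] at hε1
  obtain ⟨n, -, z₁, hz₁, hlt₁⟩ := peierls_le_iff.1 hAB.ge ε hε0 0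
  obtain ⟨m, hm, z₂, hz₂, hlt₂⟩ := peierls_le_iff.1 hBA.ge ε hε0 1
  obtain ⟨hs, hact⟩ := exists_connecting_add hK hz₁ hz₂
  set w := splice n z₁ z₂ with hw
  have hw0 : (w 0 : ℝ) ≤ t := by
    have h1 := (abs_le.1 (connecting_coord_zero hs)).1
    change _ ≤ (a : ℝ) - w 0 at h1
    linarith
  have hwn : t < (w n : ℝ) := by
    have h1 := (abs_le.1 (connecting_coord_zero hz₂)).2
    change (b : ℝ) - z₂ 0 ≤ _ at h1
    rw [hw, splice_self]
    linarith
  obtain ⟨i, hi, hi1, hi2⟩ := exists_crossing (u := fun i => (w i : ℝ)) hw0 hwn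
  have hex := (hqc (w i) (w (i + 1))).trans (hq.excess_le hK hq0 hs (by omega))
  have hMε : h (w i) (w i) - diagMin h + c * ((w i : ℝ) - w (i + 1)) ^ 2 ≤ M * ε := by
    rw [hM]
    linarith
  have hdiag : h (w i) (w i) ≤ diagMin h + M * ε := by
    have : 0 ≤ c * ((w i : ℝ) - w (i + 1)) ^ 2 := by positivity
    linarith
  have hdist : |t - w i| ≤ √(M * ε / c) := by
    refine Real.abs_le_sqrt ((le_div_iff₀ hc).2 ?_)
    have h1 := diagMin_le hK (w i)
    have h2 : (t - w i) ^ 2 ≤ ((w i : ℝ) - w (i + 1)) ^ 2 := by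
      rw [← neg_sq ((w i : ℝ) - w (i + 1))]
      exact pow_le_pow_left₀ (by linarith) (by linarith) 2
    have h3 := mul_le_mul_of_nonneg_left h2 hc.le
    linarith
  have hlip := (abs_le.1 (hK.abs_sub_le ⟨t, ht⟩ ⟨t, ht⟩ (w i) (w i))).2
  simp only [max_self] at hlip
  have := mul_le_mul_of_nonneg_left hdist K.coe_nonneg
  linarith

theorem connectedComponents_mk_eq_iff_uIcc_subset {s : Set ℝ} (a b : s) :
    ConnectedComponents.mk a = ConnectedComponents.mk b ↔ uIcc (a : ℝ) b ⊆ s := by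
  rw [ConnectedComponents.coe_eq_coe]
  constructor
  · intro hab
    have hpre : IsPreconnected ((↑) '' connectedComponent a : Set ℝ) :=
      isPreconnected_connectedComponent.image _ continuous_subtype_val.continuousOn
    have hb : b ∈ connectedComponent a := hab ▸ mem_connectedComponent
    refine (hpre.ordConnected.uIcc_subset (mem_image_of_mem _ mem_connectedComponent)
      (mem_image_of_mem _ hb)).trans ?_
    rintro _ ⟨x, -, rfl⟩
    exact x.2
  · intro hsub
    have hpre : IsPreconnected ((↑) ⁻¹' uIcc (a : ℝ) b : Set s) := by
      refine IsInducing.subtypeVal.isPreconnected_image.1 ?_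
      rw [Subtype.image_preimage_coe, inter_eq_right.2 hsub]
      exact isPreconnected_uIcc
    exact connectedComponent_eq
      (hpre.subset_connectedComponent (x := a) left_mem_uIcc right_mem_uIcc)

theorem isCompact_minSet {K : ℝ≥0} {h : ℝ → ℝ → ℝ} (hK : LipSquare K h) :
    IsCompact (minSet h) := by
  have hc : ContinuousOn (fun a => h a a) (Icc (0 : ℝ) 1) :=
    hK.continuousOn.comp (f := fun a : ℝ => (a, a)) (by fun_prop) fun a ha => ⟨ha, ha⟩
  exact isCompact_Icc.of_isClosed_subset
    (hc.preimage_isClosed_of_isClosed isClosed_Icc (isClosed_singleton (x := diagMin h)))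
    fun a ha => ha.1

/-- A map with quadratic modulus of continuity is constant on intervals: `n` equal steps cost
`O(n · n⁻²)`. -/
theorem eq_of_Icc_subset_of_dist_le_sq {M : Type*} [MetricSpace M] {s : Set ℝ} {f : s → M} {C : ℝ}
    (hf : ∀ a b : s, dist (f a) (f b) ≤ C * |(a : ℝ) - b| ^ 2) {a b : s} (hab : (a : ℝ) ≤ b)
    (hsub : Icc (a : ℝ) b ⊆ s) : f a = f b := by
  have hsteps : ∀ n : ℕ, 1 ≤ n → dist (f a) (f b) ≤ n * (C * |((b : ℝ) - a) / n| ^ 2) :=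
    fun n hn => dist_le_mul_of_equal_steps hab (f := fun t => f ⟨t, hsub t.2⟩)
      (e := fun r => C * |r| ^ 2) (fun s t _ => by
        rw [abs_sub_comm]
        exact hf _ _) hn
  have hlim : Tendsto (fun n : ℕ => C * ((b : ℝ) - a) ^ 2 / n) atTop (𝓝 0) :=
    tendsto_const_div_atTop_nhds_zero_nat _
  refine dist_le_zero.1 (ge_of_tendsto hlim ?_)
  filter_upwards [eventually_ge_atTop 1] with n hn
  refine (hsteps n hn).trans_eq ?_
  have : (n : ℝ) ≠ 0 := by exact_mod_cast (by omega : n ≠ 0)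
  rw [sq_abs]
  field_simp

/-- A continuous surjection from a compact set of reals that identifies exactly the points joined
by an interval in the set is, up to homeomorphism, the projection to the components. -/
theorem exists_homeomorph_connectedComponents {M : Type*} [TopologicalSpace M] [T2Space M]
    {s : Set ℝ} (hs : IsCompact s) {f : s → M} (hc : Continuous f)
    (hsurj : Function.Surjective f)
    (hle : ∀ a b : s, (a : ℝ) ≤ b → (f a = f b ↔ Icc (a : ℝ) b ⊆ s)) :
    ∃ ξ : ConnectedComponents s ≃ₜ M, ∀ a : s, ξ (ConnectedComponents.mk a) = f a := by
  have hfeq : ∀ a b : s, f a = f b ↔ ConnectedComponents.mk a = ConnectedComponents.mk b := by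
    intro a b
    rw [connectedComponents_mk_eq_iff_uIcc_subset]
    rcases le_total (a : ℝ) b with hab | hab
    · rw [uIcc_of_le hab, hle a b hab]
    · rw [uIcc_of_ge hab, eq_comm, hle b a hab]
  let g : ConnectedComponents s → M :=
    Quotient.lift f fun a b hab => (hfeq a b).2 (Quotient.sound hab)
  have hgc : Continuous g := hc.quotient_lift _
  have hbij : Function.Bijective g := by
    constructor
    · intro u v huv
      obtain ⟨a, rfl⟩ := ConnectedComponents.surjective_coe u
      obtain ⟨b, rfl⟩ := ConnectedComponents.surjective_coe v
      exact (hfeq a b).1 huv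
    · intro y
      obtain ⟨a, rfl⟩ := hsurj y
      exact ⟨ConnectedComponents.mk a, rfl⟩
  have : CompactSpace s := isCompact_iff_compactSpace.1 hs
  have : CompactSpace (ConnectedComponents s) := Quotient.compactSpace
  exact ⟨hgc.homeoOfEquivCompactToT2 (f := Equiv.ofBijective g hbij), fun a => rfl⟩

theorem HasExcess.exists_homeomorph {K : ℝ≥0} {h : ℝ → ℝ → ℝ} (hK : LipSquare K h) {L : ℝ≥0}
    {q : ℝ → ℝ → ℝ} (hq : HasExcess h q L) {c C : ℝ} (hc : 0 < c)
    (hqc : ∀ s t : unitInterval, h s s - diagMin h + c * ((s : ℝ) - t) ^ 2 ≤ q s t)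
    (hC : IsSubmodular fun x y => -h x y - C * (x * y))
    (hδ : IsFinitePseudoMetric (aubryDelta (potential h))) :
    ∃ ξ : ConnectedComponents (minSet h) ≃ₜ QuotientAubry (potential h) hδ,
      ∀ a : minSet h, ∃ x : aubrySet (potential h), IsConstSeq a x ∧
        ξ (ConnectedComponents.mk a) = QuotientAubry.proj (potential h) hδ x := by
  have hmem := fun x => hq.mem_aubrySet_iff hK hc hqc (x := x)
  have hopt := hq.optAverage_eq hK (excess_nonneg hK hc hqc)
  have hp : ∀ a : minSet h, constSeq ⟨a, a.2.1⟩ ∈ aubrySet (potential h) := fun a =>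
    (hmem _).2 ⟨_, a.2, rfl⟩
  obtain ⟨f, hf⟩ : ∃ f : minSet h → QuotientAubry (potential h) hδ,
      ∀ a, f a = QuotientAubry.proj _ hδ ⟨_, hp a⟩ := ⟨_, fun _ => rfl⟩
  have hfle : ∀ a b : minSet h, dist (f a) (f b) ≤ C * |(a : ℝ) - b| ^ 2 := fun a b => by
    rw [hf, hf]
    exact (dist_proj_constSeq_le hδ (hp a) (hp b) (hopt.trans a.2.2.symm)
      (hopt.trans b.2.2.symm)).trans (round_trip_le_of_isSubmodular hC _ _)
  have hcont : Continuous f := by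
    refine continuous_iff_continuousAt.2 fun b => tendsto_iff_dist_tendsto_zero.2 ?_
    refine squeeze_zero (fun _ => dist_nonneg) (fun a => hfle a b) ?_
    have : Continuous fun a : minSet h => C * |(a : ℝ) - b| ^ 2 := by fun_prop
    simpa using this.tendsto b
  have hsurj : Function.Surjective f := fun y => by
    obtain ⟨x, rfl⟩ := SeparationQuotient.surjective_mk y
    obtain ⟨a, ha, hx⟩ := (hmem x.1).1 x.2
    refine ⟨⟨a, ha⟩, (hf _).trans (congrArg (QuotientAubry.proj _ hδ) ?_)⟩
    exact Subtype.ext hx.symm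
  obtain ⟨ξ, hξ⟩ := exists_homeomorph_connectedComponents (isCompact_minSet hK) hcont hsurj
    fun a b hab => ⟨fun hfab => by
      rw [hf, hf, quotientAubry_mk_eq_iff] at hfab
      exact hq.Icc_subset_minSet hK hc hqc (a := ⟨a, a.2.1⟩) (b := ⟨b, b.2.1⟩) a.2 b.2 hfab,
      eq_of_Icc_subset_of_dist_le_sq hfle hab⟩
  exact ⟨ξ, fun a => ⟨⟨_, hp a⟩, fun _ => rfl, (hξ a).trans (hf a)⟩⟩

/-! ### A potential with a corner on the diagonal -/

theorem tangent_le_of_deriv_deriv_pos {ρ : ℝ → ℝ} (hρ : Differentiable ℝ ρ)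
    (hρ2 : ∀ t, 0 < deriv (deriv ρ) t) (t : ℝ) : ρ 0 + deriv ρ 0 * t ≤ ρ t := by
  have hconv : ConvexOn ℝ univ ρ :=
    (strictConvexOn_univ_of_deriv2_pos hρ.continuous hρ2).convexOn
  rcases lt_trichotomy t 0 with ht | rfl | ht
  · have h1 := hconv.slope_le_of_hasDerivAt (mem_univ t) (mem_univ 0) ht (hρ 0).hasDerivAt
    rw [slope_def_field, div_le_iff₀ (by linarith)] at h1
    linarith
  · simp
  · have h1 := hconv.le_slope_of_hasDerivAt (mem_univ 0) (mem_univ t) ht (hρ 0).hasDerivAt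
    rw [slope_def_field, le_div_iff₀ (by linarith)] at h1
    linarith

/-- The tangent of `ρ` at `0` contributes only a boundary term, so the corner `|x - y| / 2` is the
cost of moving, up to second order. -/
theorem exists_isometryEquiv_of_corner {K : ℝ≥0} {h : ℝ → ℝ → ℝ} (hK : LipSquare K h)
    (hδ : IsFinitePseudoMetric (aubryDelta (potential h))) {ρ : ℝ → ℝ} {r : ℝ}
    (hr : HasDerivAt ρ r 0) (htan : ∀ t, ρ 0 + r * t ≤ ρ t)
    (hρ : ∀ x ∈ Icc (0 : ℝ) 1, ∀ y ∈ Icc (0 : ℝ) 1, h x y = ρ (x - y) + 1 / 2 * |x - y|) :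
    ∃ ξ : Icc (0 : ℝ) 1 ≃ᵢ QuotientAubry (potential h) hδ,
      ∀ a : Icc (0 : ℝ) 1, ∃ x : aubrySet (potential h), IsConstSeq a x ∧
        ξ a = QuotientAubry.proj (potential h) hδ x := by
  have hdiag : ∀ x ∈ Icc (0 : ℝ) 1, h x x = ρ 0 := fun x hx => by simp [hρ x hx x hx]
  have hmin : diagMin h = ρ 0 := by
    have : (fun x => h x x) '' Icc (0 : ℝ) 1 = {ρ 0} := by
      rw [← (nonempty_Icc.2 (zero_le_one (α := ℝ))).image_const (ρ 0)]
      exact image_congr hdiag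
    rw [diagMin, this, csInf_singleton]
  have hact : ∀ (n : ℕ) (z : SeqSpace),
      ∑ i ∈ Finset.range n, 1 / 2 * |(z i : ℝ) - z (i + 1)| + r * ((z 0 : ℝ) - z n) ≤
        ∑ i ∈ Finset.range n, (h (z i) (z (i + 1)) - diagMin h) := fun n z => by
    rw [← Finset.sum_range_sub' (fun i => (z i : ℝ)), Finset.mul_sum, ← Finset.sum_add_distrib]
    refine Finset.sum_le_sum fun i _ => ?_
    rw [hρ _ (z i).2 _ (z (i + 1)).2, hmin]
    linarith [htan ((z i : ℝ) - z (i + 1))]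
  have hq : HasExcess h (fun s t => 1 / 2 * |s - t|) ‖r‖₊ := fun n z => by
    refine le_trans ?_ (hact n z)
    have h1 := neg_abs_le (r * ((z 0 : ℝ) - z n))
    rw [abs_mul, abs_sub_comm] at h1
    simp only [coe_nnnorm, Real.norm_eq_abs]
    linarith
  have hq0 : ∀ s t : unitInterval, 0 ≤ 1 / 2 * |(s : ℝ) - t| := fun s t => by positivity
  have hqc : ∀ s t : unitInterval,
      h s s - diagMin h + 1 / 2 * ((s : ℝ) - t) ^ 2 ≤ 1 / 2 * |(s : ℝ) - t| := fun s t => by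
    rw [hdiag s s.2, hmin, ← sq_abs ((s : ℝ) - t)]
    have h1 : |(s : ℝ) - t| ≤ 1 := by
      rw [abs_le]
      constructor <;> linarith [s.2.1, s.2.2, t.2.1, t.2.2]
    nlinarith [abs_nonneg ((s : ℝ) - t)]
  have hopt : ∀ a : unitInterval, optAverage (potential h) = h a a := fun a =>
    ((hq.optAverage_eq hK hq0).trans hmin).trans (hdiag a a.2).symm
  let p : Icc (0 : ℝ) 1 → aubrySet (potential h) := fun a =>
    ⟨constSeq a, constSeq_mem_aubrySet hK (hopt a)⟩
  let f : Icc (0 : ℝ) 1 → QuotientAubry (potential h) hδ := fun a =>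
    QuotientAubry.proj _ hδ (p a)
  have hlower : ∀ a b : unitInterval,
      ((1 / 2 * |(a : ℝ) - b| + r * ((a : ℝ) - b) : ℝ) : EReal) ≤
        peierls (potential h) (constSeq a) (constSeq b) := by
    intro a b
    refine le_peierls fun η hη => ⟨η / (4 * (1 / 2 + |r|)), by positivity, fun n z hz => ?_⟩
    rw [action_potential, hq.optAverage_eq hK hq0]
    refine le_trans ?_ (hact n z)
    set ε := η / (4 * (1 / 2 + |r|)) with hε
    have hεη : (1 / 2 + |r|) * (4 * ε) = η := by
      have : 1 / 2 + |r| ≠ 0 := by positivity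
      rw [hε]
      field_simp
    have h1 : |(z 0 : ℝ) - z n| ≤ ∑ i ∈ Finset.range n, |(z i : ℝ) - z (i + 1)| := by
      simpa [Real.dist_eq] using dist_le_range_sum_dist (fun i => (z i : ℝ)) n
    rw [← Finset.mul_sum]
    have h0 : |(a : ℝ) - z 0| ≤ 2 * ε := connecting_coord_zero hz
    have hn : |(z n : ℝ) - b| ≤ 2 * ε := connecting_coord_end hz
    have hd : |((a : ℝ) - b) - ((z 0 : ℝ) - z n)| ≤ 4 * ε := by
      have : ((a : ℝ) - b) - ((z 0 : ℝ) - z n) = (a - z 0) + (z n - b) := by ring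
      rw [this]
      linarith [abs_add_le ((a : ℝ) - z 0) (z n - b)]
    have h2 := abs_sub_abs_le_abs_sub ((a : ℝ) - b) ((z 0 : ℝ) - z n)
    have h3 := le_abs_self (r * (((a : ℝ) - b) - ((z 0 : ℝ) - z n)))
    rw [abs_mul] at h3
    have h4 := mul_le_mul_of_nonneg_left hd (abs_nonneg r)
    linarith
  have hge : ∀ a b : Icc (0 : ℝ) 1, |(a : ℝ) - b| ≤ dist (f a) (f b) := fun a b => by
    rw [← EReal.coe_le_coe_iff, quotientAubry_dist]
    have h1 := add_le_add (hlower a b) (hlower b a)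
    rw [← EReal.coe_add, abs_sub_comm (b : ℝ) a] at h1
    refine le_trans (EReal.coe_le_coe_iff.2 ?_) h1
    linarith
  have hle : ∀ a b : Icc (0 : ℝ) 1, (a : ℝ) ≤ b → dist (f a) (f b) ≤ |(a : ℝ) - b| := by
    intro a b hab
    have hsub : Icc (a : ℝ) b ⊆ Icc 0 1 := Icc_subset_Icc a.2.1 b.2.2
    have hsteps : ∀ n : ℕ, 1 ≤ n → dist (f a) (f b) ≤
        n * (ρ (((b : ℝ) - a) / n) + ρ (-(((b : ℝ) - a) / n)) - 2 * ρ 0 + ((b : ℝ) - a) / n) :=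
      fun n hn => dist_le_mul_of_equal_steps hab (f := fun t => f ⟨t, hsub t.2⟩)
        (e := fun s => ρ s + ρ (-s) - 2 * ρ 0 + s) (fun s t hst => by
          refine (dist_proj_constSeq_le hδ _ _ (hopt _) (hopt _)).trans_eq ?_
          simp only
          rw [hdiag _ (hsub s.2), hdiag _ (hsub t.2), hρ _ (hsub s.2) _ (hsub t.2),
            hρ _ (hsub t.2) _ (hsub s.2), abs_sub_comm (s : ℝ) t,
            abs_of_nonneg (sub_nonneg.2 hst), neg_sub]
          ring) hn
    -- the first-order parts of `ρ` forth and back cancel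
    have hder : HasDerivAt (fun s => ρ (s * (b - a)) + ρ (-(s * (b - a)))) 0 0 := by
      have hlin : HasDerivAt (fun s : ℝ => s * ((b : ℝ) - a)) (b - a) 0 := by
        simpa using (hasDerivAt_id (0 : ℝ)).mul_const ((b : ℝ) - a)
      have h1 : HasDerivAt (fun s => ρ (s * (b - a))) (r * (b - a)) 0 :=
        HasDerivAt.comp (h₂ := ρ) (h₂' := r) 0 (by simpa using hr) hlin
      have h2 : HasDerivAt (fun s => ρ (-(s * (b - a)))) (r * -(b - a)) 0 :=
        HasDerivAt.comp (h₂ := ρ) (h₂' := r) 0 (by simpa using hr) hlin.neg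
      exact (h1.add h2).congr_deriv (by ring)
    have hlim : Tendsto (fun n : ℕ => (n : ℝ) *
        (ρ (((b : ℝ) - a) / n) + ρ (-(((b : ℝ) - a) / n)) - 2 * ρ 0) + ((b : ℝ) - a)) atTop
        (𝓝 (0 + (b - a))) := by
      refine Tendsto.add_const _ ?_
      have hinv : Tendsto (fun n : ℕ => ((n : ℝ))⁻¹) atTop (𝓝[≠] 0) :=
        tendsto_nhdsWithin_iff.2 ⟨tendsto_inv_atTop_nhds_zero_nat, by
          filter_upwards [eventually_ge_atTop 1] with n hn
          exact inv_ne_zero (by exact_mod_cast (by omega : n ≠ 0))⟩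
      refine ((hasDerivAt_iff_tendsto_slope.1 hder).comp hinv).congr fun n => ?_
      simp only [Function.comp_apply, slope_def_field, zero_mul, neg_zero, sub_zero]
      rw [div_inv_eq_mul, mul_comm, inv_mul_eq_div]
      ring
    rw [abs_sub_comm, abs_of_nonneg (sub_nonneg.2 hab)]
    rw [zero_add] at hlim
    refine ge_of_tendsto hlim ?_
    filter_upwards [eventually_ge_atTop 1] with n hn
    refine (hsteps n hn).trans_eq ?_
    have : (n : ℝ) ≠ 0 := by exact_mod_cast (by omega : n ≠ 0)
    rw [mul_add, mul_div_cancel₀ _ this]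
  have hiso : Isometry f := Isometry.of_dist_eq fun a b => by
    refine le_antisymm ?_ (hge a b)
    rcases le_total (a : ℝ) b with hab | hab
    · exact hle a b hab
    · rw [dist_comm, dist_comm a b]
      exact hle b a hab
  have hsurj : Function.Surjective f := fun y => by
    obtain ⟨x, rfl⟩ := SeparationQuotient.surjective_mk y
    obtain ⟨a, -, hx⟩ := (hq.mem_aubrySet_iff hK (by norm_num : (0 : ℝ) < 1 / 2) hqc).1 x.2
    exact ⟨a, congrArg (QuotientAubry.proj _ hδ) (Subtype.ext hx.symm)⟩
  exact ⟨⟨Equiv.ofBijective f ⟨hiso.injective, hsurj⟩, hiso⟩, fun a => ⟨p a, fun _ => rfl, rfl⟩⟩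

end XYModel

theorem theoremB (h : ℝ → ℝ → ℝ) (hLip : XYModel.IsLipschitzOnSquare h) :
    -- the Aubry set is isometric to `m_h`, via `a ↦ a^∞`
    (XYModel.IsTwist h →
      ∃ ξ : XYModel.minSet h ≃ᵢ XYModel.aubrySet (XYModel.potential h),
        ∀ a : XYModel.minSet h, XYModel.IsConstSeq a (ξ a)) ∧
    -- `δ_φ` is a finite pseudometric on the Aubry set, so the quotient Aubry set is a metric space
    ∃ hδ : XYModel.IsFinitePseudoMetric (XYModel.aubryDelta (XYModel.potential h)),
      -- the quotient Aubry set is homeomorphic to the totally disconnected space of components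
      (XYModel.IsTwist h →
        TotallyDisconnectedSpace (ConnectedComponents (XYModel.minSet h)) ∧
        ∃ ξ : ConnectedComponents (XYModel.minSet h) ≃ₜ
            XYModel.QuotientAubry (XYModel.potential h) hδ,
          ∀ a : XYModel.minSet h, ∃ x : XYModel.aubrySet (XYModel.potential h),
            XYModel.IsConstSeq a x ∧
              ξ (ConnectedComponents.mk a) =
                XYModel.QuotientAubry.proj (XYModel.potential h) hδ x) ∧
      -- for the non-smooth `h`, the quotient Aubry set is isometric to `[0,1]`
      (∀ ρ : ℝ → ℝ, ContDiff ℝ 2 ρ → (∀ t : ℝ, 0 < deriv (deriv ρ) t) →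
        (∀ x ∈ Set.Icc (0 : ℝ) 1, ∀ y ∈ Set.Icc (0 : ℝ) 1,
          h x y = ρ (x - y) + 1 / 2 * |x - y|) →
        ∃ ξ : Set.Icc (0 : ℝ) 1 ≃ᵢ XYModel.QuotientAubry (XYModel.potential h) hδ,
          ∀ a : Set.Icc (0 : ℝ) 1, ∃ x : XYModel.aubrySet (XYModel.potential h),
            XYModel.IsConstSeq a x ∧
              ξ a = XYModel.QuotientAubry.proj (XYModel.potential h) hδ x) := by
  obtain ⟨K, hK⟩ := hLip
  have hδ := XYModel.isFinitePseudoMetric_aubryDelta hK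
  have htwist : XYModel.IsTwist h → ∃ (L : ℝ≥0) (q : ℝ → ℝ → ℝ) (c C : ℝ),
      XYModel.HasExcess h q L ∧ 0 < c ∧
      (∀ s t : unitInterval, h s s - XYModel.diagMin h + c * ((s : ℝ) - t) ^ 2 ≤ q s t) ∧
      XYModel.IsSubmodular fun x y => -h x y - C * (x * y) := fun hh => by
    obtain ⟨c, C, hc, hsub, hC⟩ := hh.exists_isSubmodular
    exact ⟨_, _, c / 2, C, XYModel.hasExcess_of_isSubmodular hK hsub,
      half_pos (NNReal.coe_pos.2 hc), fun _ _ => le_rfl, hC⟩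
  refine ⟨fun hh => ?_, hδ, fun hh => ⟨inferInstance, ?_⟩, fun ρ hρ hρ2 heq => ?_⟩
  · obtain ⟨L, q, c, C, hq, hc, hqc, -⟩ := htwist hh
    exact XYModel.exists_isometryEquiv_of_mem_iff fun x => hq.mem_aubrySet_iff hK hc hqc
  · obtain ⟨L, q, c, C, hq, hc, hqc, hC⟩ := htwist hh
    exact hq.exists_homeomorph hK hc hqc hC hδ
  · have hd : Differentiable ℝ ρ := hρ.differentiable (by norm_num)
    exact XYModel.exists_isometryEquiv_of_corner hK hδ (hd 0).hasDerivAt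
      (XYModel.tangent_le_of_deriv_deriv_pos hd hρ2) heq
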